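/- **Setting.** Let $n\ge 1$, let $\mathbb F_n^+$ be the free semigroup on $n$ generators, and for a tuple $X=(X_1,\dots,X_n)$ write $X_\alpha=X_{i_1}\cdots X_{i_k}$ if $\alpha=g_{i_1}\cdots g_{i_k}$, and $X_\alpha = I$ for the empty word. For a formal power series $a=\sum_\alpha a_\alpha Z_\alpha$ in noncommuting indeterminates and a tuple $X$ of bounded operators, $a(X)=\sum_{k}\sum_{|\alpha|=k}a_\alpha X_\alpha$. We say that $X$ is in the set of norm (SOT) convergence of $a$ if this series converges in norm (strongly), and in the set of radial norm (radial SOT) convergence if for some $\delta\in(0,1)$ the series converges in norm at $rX$ for all $r\in(\delta,1)$ and $a(rX)$ converges in norm (strongly) as $r\to1$; in the radial case $a(X)$ denotes the limit. Let $\mathbb H^2(f)$ be the Hilbert space in which the $f_\alpha$, $\alpha\in\mathbb F_n^+$, form an orthonormal basis. The tuple $f=(f_1,\dots,f_n)$ has the *model property*, with *universal model* $(M_{Z_1},\dots,M_{Z_n})$, $M_{Z_i}$ being the operator of left multiplication by $Z_i$ on $\mathbb H^2(f)$, if one of the following holds. * (i) $f$ is a tuple of noncommutative polynomials that is invertible under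 composition by a tuple of polynomials; here $\mathbb H^2(f)$ is the completion of the space of polynomials. * (ii) The $f_i$ are formal power series with $f(0)=0$, nonzero radius of convergence and $\det J_f(0)\ne0$; each $Z_i$ lies in the space $\mathbb H^2(f)$ of formal power series $\sum_\alpha c_\alpha f_\alpha$, $\sum|c_\alpha|^2<\infty$; each $M_{Z_i}$ is bounded; and $M_{f_j}=f_j(M_{Z_1},\dots,M_{Z_n})$ for all $j$, where $(M_{Z_i})$ is in the set of SOT convergence, or of radial SOT convergence, of $f$. * (iii) For some $\gamma>0$ the $f_i$ are free holomorphic functions on the ball $\{X\in B(\mathcal H)^n:\|\sum X_iX_i^*\|^{1/2}<\gamma\}$ ($\mathcal H$ an infinite dimensional Hilbert space), with $f$ mapping this ball into the open unit ball; there is no nonzero free holomorphic function $G$ on the open unit ball with $G\circ f=0$; the coordinate functions lie in $\mathbb H^2(f)=\{\sum_\alpha c_\alpha f_\alpha:\sum|c_\alpha|^2<\infty\}$ (a space of functions on the $\gamma$-ball), and multiplication by each of them is bounded; and $M_{f_j}=f_j(M_{Z_1},\dots,M_{Z_n})$ as in (ii). The class $\mathcal M^{\parallel}$ consists of the $f$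 with the model property whose universal model is in the set of norm convergence, or of radial norm convergence, of $f$. Let $C^*(M_Z)=C^*(M_{Z_1},\dots,M_{Z_n})\subseteq B(\mathbb H^2(f))$ be the unital $C^*$-algebra generated by the $M_{Z_i}$. **Theorem.** Let $f\in\mathcal M^{\parallel}$, with universal model $(M_{Z_1},\dots,M_{Z_n})$, and let $\pi:C^*(M_Z)\to B(\mathcal K)$ be a nondegenerate $*$-representation on a separable Hilbert space $\mathcal K$. Then the evaluations $f_i(\pi(M_Z)):=f_i(\pi(M_{Z_1}),\dots,\pi(M_{Z_n}))$ exist (as norm or radial norm limits). Put $$\Delta_\pi:=I-\sum_{i=1}^n f_i(\pi(M_Z))f_i(\pi(M_Z))^*,\qquad \mathcal K_0:=\overline{\operatorname{span}}\{\pi(M_{Z_\alpha})\Delta_\pi\mathcal K:\alpha\in\mathbb F_n^+\},\qquad \mathcal K_1:=\mathcal K_0^\perp .$$ Both subspaces are invariant under $\pi$, so $\pi=\pi_0\oplus\pi_1$ on $\mathcal K=\mathcal K_0\oplus\mathcal K_1$; the representations $\pi_0,\pi_1$ are disjoint; and the following hold. 1. There are a separable Hilbert space $\mathcal G$ with $\dim\mathcal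 G=\dim(\operatorname{range}\Delta_\pi)$ (Hilbert space dimension) and a unitary $\mathbb H^2(f)\otimes\mathcal G\to\mathcal K_0$ under which $\pi_0(X)$ corresponds to $X\otimes I_{\mathcal G}$ for all $X\in C^*(M_Z)$. 2. All compact operators on $\mathbb H^2(f)$ belong to $C^*(M_Z)$, and $\pi_1$ annihilates them. The evaluations $f_i(\pi_1(M_Z))$ exist, and $\sum_{i=1}^n f_i(\pi_1(M_Z))f_i(\pi_1(M_Z))^*=I_{\mathcal K_1}$. 3. If $\pi'$ is another nondegenerate $*$-representation of $C^*(M_Z)$ on a separable Hilbert space, with the corresponding $\pi_0'$, $\pi_1'$ and $\mathcal G'$ (so that $\pi'_0$ is unitarily equivalent to $X\mapsto X\otimes I_{\mathcal G'}$), then $\pi$ and $\pi'$ are unitarily equivalent if and only if $\dim\mathcal G=\dim\mathcal G'$ and $\pi_1$ is unitarily equivalent to $\pi_1'$. -/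

import Mathlib

open Filter Topology Set
open scoped ENNReal TensorProduct InnerProductSpace

noncomputable section

namespace NCDomain

/-! ## Formal power series in noncommuting indeterminates

The free semigroup on `n` generators is `FreeMonoid (Fin n)`; its identity is the empty word `1`. -/

instance {n : ℕ} : DecidableEq (FreeMonoid (Fin n)) := inferInstanceAs (DecidableEq (List (Fin n)))

/-- Formal power series `∑ a_α Z_α` in noncommuting indeterminates `Z_1, …, Z_n`, given by the
family of their coefficients. -/
abbrev NCSeries (n : ℕ) : Type := FreeMonoid (Fin n) → ℂ

/-- The word `g_{w 0} ⋯ g_{w (k-1)}`; every word of length `k` is `word w` for exactly one `w`. -/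
def word {n k : ℕ} (w : Fin k → Fin n) : FreeMonoid (Fin n) := FreeMonoid.ofList (List.ofFn w)

/-- The series with the single term `Z_α`. -/
def mono {n : ℕ} (α : FreeMonoid (Fin n)) : NCSeries n := fun β => if β = α then 1 else 0

/-- The indeterminate `Z_i`, as a series. -/
def Zvar {n : ℕ} (i : Fin n) : NCSeries n := mono (FreeMonoid.of i)

/-- The product of formal power series: the coefficient at a word is the sum over all ways of
cutting the word in two. -/
def cauchyMul {n : ℕ} (a b : NCSeries n) : NCSeries n := fun γ =>
  ∑ k ∈ Finset.range (γ.toList.length + 1),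
    a (FreeMonoid.ofList (γ.toList.take k)) * b (FreeMonoid.ofList (γ.toList.drop k))

/-- `f_α = f_{i_1} ⋯ f_{i_k}` for the word with letters `i_1, …, i_k`. -/
def wordListProd {n : ℕ} (f : Fin n → NCSeries n) : List (Fin n) → NCSeries n
  | [] => mono 1
  | i :: l => cauchyMul (f i) (wordListProd f l)

/-- `f_α` for a word `α`, with `f_α = 1` for the empty word. -/
def wordProd {n : ℕ} (f : Fin n → NCSeries n) (α : FreeMonoid (Fin n)) : NCSeries n :=
  wordListProd f α.toList

/-- The reciprocal `limsup_k (∑_{|α| = k} |a_α|²)^{1/2k}` of the radius of convergence. -/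
def invRadius {n : ℕ} (a : NCSeries n) : ℝ≥0∞ :=
  limsup (fun k : ℕ => ENNReal.ofReal
    ((∑ w : Fin k → Fin n, ‖a (word w)‖ ^ 2) ^ (1 / (2 * (k : ℝ))))) atTop

/-- The Jacobian matrix `[∂ f_i / ∂ Z_j]` at `0`. -/
def jacobian {n : ℕ} (f : Fin n → NCSeries n) : Matrix (Fin n) (Fin n) ℂ :=
  Matrix.of fun i j => f i (FreeMonoid.of j)

/-! ## Evaluation of series at tuples of operators -/

section Eval

variable {n : ℕ} {K : Type*} [NormedAddCommGroup K] [InnerProductSpace ℂ K]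

/-- `X_α = X_{i_1} ⋯ X_{i_k}`, with `X_α = I` for the empty word. -/
def opWord (X : Fin n → (K →L[ℂ] K)) (α : FreeMonoid (Fin n)) : K →L[ℂ] K :=
  FreeMonoid.lift X α

/-- `∑_{k < m} ∑_{|α| = k} a_α X_α`. -/
def partialSum (a : NCSeries n) (X : Fin n → (K →L[ℂ] K)) (m : ℕ) : K →L[ℂ] K :=
  ∑ k ∈ Finset.range m, ∑ w : Fin k → Fin n, a (word w) • opWord X (word w)

/-- `∑_k ∑_{|α| = k} a_α X_α = T` with convergence in the operator norm. -/
def NormSum (a : NCSeries n) (X : Fin n → (K →L[ℂ] K)) (T : K →L[ℂ] K) : Prop :=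
  Tendsto (partialSum a X) atTop (𝓝 T)

/-- `∑_k ∑_{|α| = k} a_α X_α = T` with convergence in the strong operator topology. -/
def SOTSum (a : NCSeries n) (X : Fin n → (K →L[ℂ] K)) (T : K →L[ℂ] K) : Prop :=
  ∀ x : K, Tendsto (fun m => partialSum a X m x) atTop (𝓝 (T x))

/-- For some `δ ∈ (0,1)` the series converges in norm at `r X` for all `r ∈ (δ,1)`, and the sums
converge to `T` in the operator norm as `r → 1`. -/
def RadNormSum (a : NCSeries n) (X : Fin n → (K →L[ℂ] K)) (T : K →L[ℂ] K) : Prop :=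
  ∃ δ ∈ Ioo (0 : ℝ) 1, ∃ F : ℝ → (K →L[ℂ] K),
    (∀ r ∈ Ioo δ 1, NormSum a (fun i => (r : ℂ) • X i) (F r)) ∧ Tendsto F (𝓝[<] 1) (𝓝 T)

/-- For some `δ ∈ (0,1)` the series converges in norm at `r X` for all `r ∈ (δ,1)`, and the sums
converge to `T` in the strong operator topology as `r → 1`. -/
def RadSOTSum (a : NCSeries n) (X : Fin n → (K →L[ℂ] K)) (T : K →L[ℂ] K) : Prop :=
  ∃ δ ∈ Ioo (0 : ℝ) 1, ∃ F : ℝ → (K →L[ℂ] K),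
    (∀ r ∈ Ioo δ 1, NormSum a (fun i => (r : ℂ) • X i) (F r)) ∧
      ∀ x : K, Tendsto (fun r => F r x) (𝓝[<] 1) (𝓝 (T x))

/-- `T` is the value of the series `a` at `X`, in the sense of norm convergence or of radial
norm convergence (by Abel's theorem the two agree when both apply). -/
def HasNormEval (a : NCSeries n) (X : Fin n → (K →L[ℂ] K)) (T : K →L[ℂ] K) : Prop :=
  NormSum a X T ∨ RadNormSum a X T

/-- The value `a(X_1, …, X_n)`, meaningful when some `T` satisfies `HasNormEval a X T`. -/
def opEval (a : NCSeries n) (X : Fin n → (K →L[ℂ] K)) : K →L[ℂ] K :=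
  Classical.epsilon fun T => HasNormEval a X T

/-- The value at `X` of a free holomorphic function: the norm limit of the partial sums. -/
def holEval (a : NCSeries n) (X : Fin n → (K →L[ℂ] K)) : K →L[ℂ] K :=
  limUnder atTop (partialSum a X)

/-- The open operatorial ball `[B(K)^n]_r` of all `X` with `‖∑ X_i X_i*‖^{1/2} < r`. -/
def opBall [CompleteSpace K] (n : ℕ) (r : ℝ) : Set (Fin n → (K →L[ℂ] K)) :=
  {X | Real.sqrt ‖∑ i, X i * star (X i)‖ < r}

end Eval

/-! ## The Hilbert space `ℍ²(f)` and the universal model -/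

/-- The Hilbert space `ℍ²(f)` in its orthonormal basis `(f_α)_α`: a square summable family
`(c_α)` stands for the element `∑ c_α f_α`. How such an element is realized (as a limit of
polynomials, as a formal power series, or as a free holomorphic function) depends on `f`, and is
recorded in the definitions of left multiplication below. -/
abbrev H2 (n : ℕ) : Type := lp (fun _ : FreeMonoid (Fin n) => ℂ) 2

/-- A fixed separable infinite dimensional Hilbert space, on which free holomorphic functions
are evaluated. -/
abbrev HInf : Type := lp (fun _ : ℕ => ℂ) 2

section Model

variable {n : ℕ}

/-- The finite combination `∑ c_α f_α` as an element of `ℍ²(f)`. -/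
def finVec (c : FreeMonoid (Fin n) →₀ ℂ) : H2 n := c.sum fun α r => lp.single 2 α r

/-- The polynomial `∑ c_α p_α`, for a tuple of polynomials `p`. -/
def polyComb (p : Fin n → FreeAlgebra ℂ (Fin n)) (c : FreeMonoid (Fin n) →₀ ℂ) :
    FreeAlgebra ℂ (Fin n) := c.sum fun α r => r • FreeMonoid.lift p α

/-- The tuple of polynomials `p` is invertible with respect to composition. -/
def PolyInvertible (p : Fin n → FreeAlgebra ℂ (Fin n)) : Prop :=
  ∃ q : Fin n → FreeAlgebra ℂ (Fin n), ∀ i,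
    FreeAlgebra.lift ℂ q (p i) = FreeAlgebra.ι ℂ i ∧ FreeAlgebra.lift ℂ p (q i) = FreeAlgebra.ι ℂ i

/-- `T` is the left multiplication by the polynomial `u` on `ℍ²(p)`, the completion of the space
of polynomials for the inner product in which the `p_α` are orthonormal: for every polynomial
`∑ c_α p_α`, `T` maps it to `u ∑ c_α p_α`. -/
def IsMulPoly (p : Fin n → FreeAlgebra ℂ (Fin n)) (u : FreeAlgebra ℂ (Fin n))
    (T : H2 n →L[ℂ] H2 n) : Prop :=
  ∀ c, ∃ d, polyComb p d = u * polyComb p c ∧ T (finVec c) = finVec d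

/-- `f` is a tuple of polynomials with property `(𝒜)`, and `M_i` is the multiplication by
`Z_i` on `ℍ²(f)`. -/
def ModelA (f : Fin n → NCSeries n) (M : Fin n → (H2 n →L[ℂ] H2 n)) : Prop :=
  ∃ p : Fin n → FreeAlgebra ℂ (Fin n),
    (∀ i α, f i α = (FreeAlgebra.equivMonoidAlgebraFreeMonoid (p i)).coeff α) ∧
    PolyInvertible p ∧ ∀ i, IsMulPoly p (FreeAlgebra.ι ℂ i) (M i)

/-- The formal power series `∑ c_α f_α`, for `f` with `f(0) = 0`: only the words `α` with
`|α| ≤ |β|` contribute to its coefficient at `β`. -/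
def formalComb (f : Fin n → NCSeries n) (c : H2 n) : NCSeries n := fun β =>
  ∑ k ∈ Finset.range (β.toList.length + 1), ∑ w : Fin k → Fin n,
    c (word w) * wordProd f (word w) β

/-- `T` is the left multiplication by the series `u` on the space `ℍ²(f)` of formal power
series. -/
def IsMulFormal (f : Fin n → NCSeries n) (u : NCSeries n) (T : H2 n →L[ℂ] H2 n) : Prop :=
  ∀ c, formalComb f (T c) = cauchyMul u (formalComb f c)

/-- `f` is a tuple of formal power series with `f(0) = 0` and property `(𝒮)`, and `M_i` is the
multiplication by `Z_i` on `ℍ²(f)`. -/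
structure ModelS (f : Fin n → NCSeries n) (M : Fin n → (H2 n →L[ℂ] H2 n)) : Prop where
  map_zero : ∀ i, f i 1 = 0
  radius : ∀ i, invRadius (f i) < ⊤
  jacobian_ne : (jacobian f).det ≠ 0
  mem : ∀ i, ∃ c : H2 n, formalComb f c = Zvar i
  isMul : ∀ i, IsMulFormal f (Zvar i) (M i)
  eval : (∀ j, ∃ T, SOTSum (f j) M T ∧ IsMulFormal f (f j) T) ∨
    (∀ j, ∃ T, RadSOTSum (f j) M T ∧ IsMulFormal f (f j) T)

/-- The value `(∑ c_α φ_α)(X) = G(φ(X))`, where `G = ∑ c_α Z_α` is in the Hardy space of the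
unit ball. -/
def holComb (φ : Fin n → NCSeries n) (c : H2 n) (X : Fin n → (HInf →L[ℂ] HInf)) :
    HInf →L[ℂ] HInf :=
  holEval (fun α => c α) fun i => holEval (φ i) X

/-- `T` is the left multiplication by the free holomorphic function `u` on the space `ℍ²(φ)`
of free holomorphic functions on the ball of radius `γ`. -/
def IsMulHol (γ : ℝ) (φ : Fin n → NCSeries n) (u : NCSeries n) (T : H2 n →L[ℂ] H2 n) : Prop :=
  ∀ c, ∀ X ∈ opBall n γ, holComb φ (T c) X = holEval u X * holComb φ c X

/-- `φ` is a tuple of free holomorphic functions on the ball of radius `γ` with property `(ℱ)`,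
and `M_i` is the multiplication by the coordinate function `X_i` on `ℍ²(φ)`. -/
structure ModelF (γ : ℝ) (φ : Fin n → NCSeries n) (M : Fin n → (H2 n →L[ℂ] H2 n)) : Prop where
  pos : 0 < γ
  hol : ∀ X ∈ opBall (K := HInf) n γ, ∀ i, ∃ T, NormSum (φ i) X T
  range : ∀ X ∈ opBall (K := HInf) n γ, (fun i => holEval (φ i) X) ∈ opBall n 1
  not_zero_divisor : ∀ G : NCSeries n, invRadius G ≤ 1 →
    (∀ X ∈ opBall (K := HInf) n γ, holEval G (fun i => holEval (φ i) X) = 0) → G = 0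
  mem : ∀ i, ∃ c : H2 n, ∀ X ∈ opBall n γ, holComb φ c X = X i
  isMul : ∀ i, IsMulHol γ φ (Zvar i) (M i)
  eval : (∀ j, ∃ T, SOTSum (φ j) M T ∧ IsMulHol γ φ (φ j) T) ∨
    (∀ j, ∃ T, RadSOTSum (φ j) M T ∧ IsMulHol γ φ (φ j) T)

/-- `f` has the model property, and `M = (M_{Z_1}, …, M_{Z_n})` is its universal model. -/
def IsUniversalModel (f : Fin n → NCSeries n) (M : Fin n → (H2 n →L[ℂ] H2 n)) : Prop :=
  ModelA f M ∨ ModelS f M ∨ ∃ γ, ModelF γ f M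

/-- `f` is in the class `ℳ^∥`, and `M` is its universal model: `f` has the model property and
`M` is in the set of norm convergence, or of radial norm convergence, of `f`. -/
def IsParallelModel (f : Fin n → NCSeries n) (M : Fin n → (H2 n →L[ℂ] H2 n)) : Prop :=
  IsUniversalModel f M ∧
    ((∀ i, ∃ T, NormSum (f i) M T) ∨ (∀ i, ∃ T, RadNormSum (f i) M T))

/-- The (unital) C*-algebra `C*(M_1, …, M_n)` generated by the operators `M_i`. -/
def cstar (M : Fin n → (H2 n →L[ℂ] H2 n)) : StarSubalgebra ℂ (H2 n →L[ℂ] H2 n) :=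
  (StarAlgebra.adjoin ℂ (Set.range M)).topologicalClosure

/-- The generator `M_i`, as an element of `C*(M_1, …, M_n)`. -/
def gen (M : Fin n → (H2 n →L[ℂ] H2 n)) (i : Fin n) : cstar M :=
  ⟨M i, StarSubalgebra.le_topologicalClosure _
    (StarAlgebra.subset_adjoin ℂ _ (Set.mem_range_self i))⟩

end Model

/-! ## Representations -/

section Rep

variable {n : ℕ} {M : Fin n → (H2 n →L[ℂ] H2 n)}
variable {K : Type*} [NormedAddCommGroup K] [InnerProductSpace ℂ K] [CompleteSpace K]
variable {L : Type*} [NormedAddCommGroup L] [InnerProductSpace ℂ L] [CompleteSpace L]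

variable (M K) in
/-- The `*`-representations of `C*(M_1, …, M_n)` on `K` (not assumed to be unital). -/
abbrev StarRep : Type _ := cstar M →⋆ₙₐ[ℂ] (K →L[ℂ] K)

/-- The vectors `π(X) x` span a dense subspace. -/
def Nondegenerate (π : StarRep M K) : Prop :=
  (Submodule.span ℂ {y : K | ∃ a x, y = π a x}).topologicalClosure = ⊤

/-- The tuple `(π(M_1), …, π(M_n))`. -/
def repTuple (π : StarRep M K) (i : Fin n) : K →L[ℂ] K := π (gen M i)

/-- `I - ∑ f_i(X) f_i(X)*`. -/
def defect (f : Fin n → NCSeries n) (X : Fin n → (K →L[ℂ] K)) : K →L[ℂ] K :=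
  1 - ∑ i, opEval (f i) X * star (opEval (f i) X)

/-- The closed span of the subspaces `π(M_{Z_α}) (I - ∑ f_i(π(M_Z)) f_i(π(M_Z))*) K`, where
`α` runs over all words. -/
def woldSpace (f : Fin n → NCSeries n) (π : StarRep M K) : Submodule ℂ K :=
  (Submodule.span ℂ {y : K | ∃ α x,
    y = π (FreeMonoid.lift (gen M) α) (defect f (repTuple π) x)}).topologicalClosure

instance (f : Fin n → NCSeries n) (π : StarRep M K) : CompleteSpace (woldSpace f π) :=
  Submodule.topologicalClosure.completeSpace _

/-- The subspace `V` is invariant under `π`, and `σ` is the restriction of `π` to it. -/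
def IsRestriction (π : StarRep M K) (V : Submodule ℂ K) [CompleteSpace V] (σ : StarRep M V) : Prop :=
  ∀ a (x : V), ((σ a x : V) : K) = π a x

/-- The representations are disjoint: there is no nonzero bounded intertwining operator. -/
def DisjointRep (σ : StarRep M K) (τ : StarRep M L) : Prop :=
  ∀ T : K →L[ℂ] L, (∀ a x, T (σ a x) = τ a (T x)) → T = 0

/-- Unitary equivalence of representations. -/
def UnitarilyEquiv (σ : StarRep M K) (τ : StarRep M L) : Prop :=
  ∃ U : K ≃ₗᵢ[ℂ] L, ∀ a x, U (σ a x) = τ a (U x)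

/-- Up to a unitary, `σ` is the representation `X ↦ X ⊗ I_G` on the Hilbert space tensor product
`ℍ²(f) ⊗ G` (the completion of the algebraic one). -/
def IsMultipleOfId (σ : StarRep M K) (G : Type*) [NormedAddCommGroup G] [InnerProductSpace ℂ G] :
    Prop :=
  ∃ U : UniformSpace.Completion (H2 n ⊗[ℂ] G) ≃ₗᵢ[ℂ] K, ∀ (a : cstar M) (h : H2 n) (g : G),
    σ a (U ((h ⊗ₜ[ℂ] g : H2 n ⊗[ℂ] G) : UniformSpace.Completion (H2 n ⊗[ℂ] G))) =
      U ((((a : H2 n →L[ℂ] H2 n) h) ⊗ₜ[ℂ] g : H2 n ⊗[ℂ] G) :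
        UniformSpace.Completion (H2 n ⊗[ℂ] G))

/-- The Hilbert space dimension of a separable space: the largest cardinality (finite or
countably infinite, written `⊤`) of an orthonormal set. -/
def hilbertDim (E : Type*) [NormedAddCommGroup E] [InnerProductSpace ℂ E] : ℕ∞ :=
  ⨆ s : {s : Set E // Orthonormal ℂ ((↑) : s → E)}, (s : Set E).encard

end Rep

end NCDomain

end

universe u v w

open NCDomain

/-! The representation theory of the compact operators drives the theorem; the point is to find the
compacts inside `cstar M`. In each of the three cases of the model property, left multiplication by
`f_j` is forced to be the creation operator `f_α ↦ f_j f_α`, because the coefficients of `∑ c_α f_α`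
are determined by that element: by composition with the inverse tuple for polynomials, by
invertibility of the tensor powers of the Jacobian for formal series, and by the absence of nonzero
`G` with `G ∘ f = 0` for holomorphic functions. All notions of evaluation imply a weak one, whose
value is unique, so the norm evaluation `f_j(M_Z)` is that creation operator
(`IsParallelModel.hasNormEval`) and lies in `cstar M`.

The identity minus the sum of the `creation j * star (creation j)` is the projection onto the vacuum
`f_∅ = 1` (`one_sub_sum_creation`). The vacuum is cyclic for the `M_{Z_i}`, since closed subspaces
invariant under them are invariant under the creation operators. Hence all rank one operators
(`IsParallelModel.ketBra_mem`), and with them all compact operators, belong to `cstar M`.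

A nondegenerate `π` is unital and contractive, so it carries evaluations to evaluations, and `Δ_π`
is the image of the vacuum projection. With `e_{x,1}` the operator `z ↦ ⟨1, z⟩ x`, the relations
between rank one operators show that `x ⊗ g ↦ π(e_{x,1}) g`, for `g` in the range of `Δ_π`, extends
to a unitary onto `𝒦₀` that intertwines `X ⊗ I` with `π₀`. On `𝒦₁` every rank one operator acts as
zero; this gives disjointness and the row identity. A unitary equivalence respects all these spaces,
and conversely one is assembled from a unitary between the defect ranges and one between the
complements. -/

noncomputable section

namespace NCDomain

/-! ### Uniqueness of the value of a series at a tuple -/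

section WeakEval

variable {n : ℕ} {K : Type*} [NormedAddCommGroup K] [InnerProductSpace ℂ K]

/-- `∑_k ∑_{|α| = k} a_α X_α = T` with convergence in the weak operator topology. -/
def WeakSum (a : NCSeries n) (X : Fin n → (K →L[ℂ] K)) (T : K →L[ℂ] K) : Prop :=
  ∀ x y : K, Tendsto (fun m => ⟪y, partialSum a X m x⟫_ℂ) atTop (𝓝 ⟪y, T x⟫_ℂ)

/-- The radial version of `WeakSum`. -/
def RadWeakSum (a : NCSeries n) (X : Fin n → (K →L[ℂ] K)) (T : K →L[ℂ] K) : Prop :=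
  ∃ δ ∈ Ioo (0 : ℝ) 1, ∃ F : ℝ → (K →L[ℂ] K),
    (∀ r ∈ Ioo δ 1, WeakSum a (fun i => (r : ℂ) • X i) (F r)) ∧
      ∀ x y : K, Tendsto (fun r => ⟪y, F r x⟫_ℂ) (𝓝[<] 1) (𝓝 ⟪y, T x⟫_ℂ)

/-- `T` is the value of `a` at `X` in the weak or in the radial weak sense. -/
def HasWeakEval (a : NCSeries n) (X : Fin n → (K →L[ℂ] K)) (T : K →L[ℂ] K) : Prop :=
  WeakSum a X T ∨ RadWeakSum a X T

lemma SOTSum.weakSum {a : NCSeries n} {X : Fin n → (K →L[ℂ] K)} {T : K →L[ℂ] K}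
    (h : SOTSum a X T) : WeakSum a X T := fun x _ => tendsto_const_nhds.inner (h x)

lemma NormSum.sotSum {a : NCSeries n} {X : Fin n → (K →L[ℂ] K)} {T : K →L[ℂ] K}
    (h : NormSum a X T) : SOTSum a X T := fun x =>
  ((ContinuousLinearMap.apply ℂ K x).continuous.tendsto T).comp h

lemma RadSOTSum.radWeakSum {a : NCSeries n} {X : Fin n → (K →L[ℂ] K)} {T : K →L[ℂ] K}
    (h : RadSOTSum a X T) : RadWeakSum a X T := by
  obtain ⟨δ, hδ, F, hF, hT⟩ := h
  exact ⟨δ, hδ, F, fun r hr => (hF r hr).sotSum.weakSum, fun x y => tendsto_const_nhds.inner (hT x)⟩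

lemma RadNormSum.radSOTSum {a : NCSeries n} {X : Fin n → (K →L[ℂ] K)} {T : K →L[ℂ] K}
    (h : RadNormSum a X T) : RadSOTSum a X T := by
  obtain ⟨δ, hδ, F, hF, hT⟩ := h
  exact ⟨δ, hδ, F, hF, fun x => ((ContinuousLinearMap.apply ℂ K x).continuous.tendsto T).comp hT⟩

lemma HasNormEval.hasWeakEval {a : NCSeries n} {X : Fin n → (K →L[ℂ] K)} {T : K →L[ℂ] K}
    (h : HasNormEval a X T) : HasWeakEval a X T :=
  h.imp (fun h => h.sotSum.weakSum) fun h => h.radSOTSum.radWeakSum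

lemma opWord_word_smul (X : Fin n → (K →L[ℂ] K)) (r : ℂ) {k : ℕ} (w : Fin k → Fin n) :
    opWord (fun i => r • X i) (word w) = r ^ k • opWord X (word w) := by
  have key : ∀ l : List (Fin n), (l.map fun i => r • X i).prod = r ^ l.length • (l.map X).prod := by
    intro l
    induction l with
    | nil => simp
    | cons i l ih =>
      simp [ih, pow_succ, smul_smul, mul_comm]
  have := key (List.ofFn w)
  simpa [opWord, word, FreeMonoid.lift_apply] using this

/-- The homogeneous part of degree `k` of the evaluation of `a` at `X`. -/
def homPart (a : NCSeries n) (X : Fin n → (K →L[ℂ] K)) (k : ℕ) : K →L[ℂ] K :=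
  ∑ w : Fin k → Fin n, a (word w) • opWord X (word w)

lemma partialSum_eq_sum_homPart (a : NCSeries n) (X : Fin n → (K →L[ℂ] K)) (m : ℕ) :
    partialSum a X m = ∑ k ∈ Finset.range m, homPart a X k := rfl

lemma homPart_smul (a : NCSeries n) (X : Fin n → (K →L[ℂ] K)) (r : ℂ) (k : ℕ) :
    homPart a (fun i => r • X i) k = r ^ k • homPart a X k := by
  simp only [homPart, opWord_word_smul, Finset.smul_sum]
  exact Finset.sum_congr rfl fun w _ => smul_comm _ _ _

lemma inner_partialSum_smul (a : NCSeries n) (X : Fin n → (K →L[ℂ] K)) (r : ℂ) (m : ℕ) (x y : K) :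
    ⟪y, partialSum a (fun i => r • X i) m x⟫_ℂ =
      ∑ k ∈ Finset.range m, ⟪y, homPart a X k x⟫_ℂ * r ^ k := by
  simp [partialSum_eq_sum_homPart, homPart_smul, mul_comm]

lemma WeakSum.eq {a : NCSeries n} {X : Fin n → (K →L[ℂ] K)} {T T' : K →L[ℂ] K}
    (h : WeakSum a X T) (h' : WeakSum a X T') : T = T' :=
  ContinuousLinearMap.ext fun x => ext_inner_left ℂ fun y => tendsto_nhds_unique (h x y) (h' x y)

/-- Abel's theorem. -/
lemma WeakSum.eq_of_radWeakSum {a : NCSeries n} {X : Fin n → (K →L[ℂ] K)} {T T' : K →L[ℂ] K}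
    (h : WeakSum a X T) (h' : RadWeakSum a X T') : T = T' := by
  obtain ⟨δ, hδ, F, hF, hT⟩ := h'
  refine ContinuousLinearMap.ext fun x => ext_inner_left ℂ fun y => ?_
  -- Tested against two vectors, the series at `r X` becomes a scalar power series in `r`, to which
  -- the scalar Abel theorem applies.
  have h1 : Tendsto (fun m => ∑ k ∈ Finset.range m, ⟪y, homPart a X k x⟫_ℂ) atTop
      (𝓝 ⟪y, T x⟫_ℂ) := by
    simpa [partialSum_eq_sum_homPart, inner_sum] using h x y
  have h2 := Complex.tendsto_tsum_powerSeries_nhdsWithin_lt h1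
  rw [tendsto_map'_iff] at h2
  refine tendsto_nhds_unique h2 ((hT x y).congr' ?_)
  have : Ioo δ 1 ∈ 𝓝[<] (1 : ℝ) := Ioo_mem_nhdsLT hδ.2
  filter_upwards [this] with r hr
  have hr1 : ‖(r : ℂ)‖ < 1 := by
    rw [Complex.norm_real, Real.norm_of_nonneg (hδ.1.trans hr.1).le]; exact hr.2
  have h3 := (summable_powerSeries_of_norm_lt_one h1.cauchySeq hr1).hasSum.tendsto_sum_nat
  have h4 := hF r hr x y
  simp only [inner_partialSum_smul] at h4
  exact tendsto_nhds_unique h4 h3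

lemma RadWeakSum.eq {a : NCSeries n} {X : Fin n → (K →L[ℂ] K)} {T T' : K →L[ℂ] K}
    (h : RadWeakSum a X T) (h' : RadWeakSum a X T') : T = T' := by
  obtain ⟨δ, hδ, F, hF, hT⟩ := h
  obtain ⟨δ', hδ', F', hF', hT'⟩ := h'
  refine ContinuousLinearMap.ext fun x => ext_inner_left ℂ fun y => ?_
  refine tendsto_nhds_unique (hT x y) ((hT' x y).congr' ?_)
  filter_upwards [Ioo_mem_nhdsLT hδ.2, Ioo_mem_nhdsLT hδ'.2] with r hr hr'
  rw [(hF r hr).eq (hF' r hr')]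

/-- The model property provides strong or radial strong values, membership in `ℳ^∥` norm or radial
norm ones. All are weak values, and this uniqueness is what identifies them. -/
lemma HasWeakEval.eq {a : NCSeries n} {X : Fin n → (K →L[ℂ] K)} {T T' : K →L[ℂ] K}
    (h : HasWeakEval a X T) (h' : HasWeakEval a X T') : T = T' := by
  rcases h with h | h <;> rcases h' with h' | h'
  · exact h.eq h'
  · exact h.eq_of_radWeakSum h'
  · exact (h'.eq_of_radWeakSum h).symm
  · exact h.eq h'

lemma HasNormEval.opEval_eq {a : NCSeries n} {X : Fin n → (K →L[ℂ] K)} {T : K →L[ℂ] K}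
    (h : HasNormEval a X T) : opEval a X = T :=
  (HasNormEval.hasWeakEval (Classical.epsilon_spec ⟨T, h⟩)).eq h.hasWeakEval

end WeakEval

/-! ### Representations carry evaluations to evaluations -/

section Image

variable {n : ℕ} {M : Fin n → (H2 n →L[ℂ] H2 n)}
variable {K : Type*} [NormedAddCommGroup K] [InnerProductSpace ℂ K] [CompleteSpace K]

lemma isClosed_cstar (M : Fin n → (H2 n →L[ℂ] H2 n)) :
    IsClosed (cstar M : Set (H2 n →L[ℂ] H2 n)) :=
  StarSubalgebra.isClosed_topologicalClosure _

instance (M : Fin n → (H2 n →L[ℂ] H2 n)) : CompleteSpace (cstar M) :=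
  (isClosed_cstar M).completeSpace_coe

instance (M : Fin n → (H2 n →L[ℂ] H2 n)) : CStarAlgebra (cstar M) where

lemma gen_mem (M : Fin n → (H2 n →L[ℂ] H2 n)) (i : Fin n) : M i ∈ cstar M := (gen M i).2

/-- Automatic continuity: a `*`-homomorphism between C*-algebras is contractive. -/
lemma continuous_starRep (π : StarRep M K) : Continuous π :=
  AddMonoidHomClass.continuous_of_bound π 1 fun a => by
    simpa using NonUnitalStarAlgHom.norm_apply_le π a

/-- A nondegenerate representation of a unital algebra is unital. -/
lemma Nondegenerate.map_one {π : StarRep M K} (h : Nondegenerate π) : π 1 = 1 := by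
  have hs : (⊤ : Submodule ℂ K) ≤ LinearMap.eqLocus (π 1).toLinearMap
      (1 : K →L[ℂ] K).toLinearMap := by
    rw [← h]
    refine Submodule.topologicalClosure_minimal _ (Submodule.span_le.2 ?_)
      (isClosed_eq (π 1).continuous (1 : K →L[ℂ] K).continuous)
    rintro _ ⟨a, x, rfl⟩
    change (π 1) (π a x) = π a x
    rw [← mul_apply_eq_comp, ← map_mul, one_mul]
  exact ContinuousLinearMap.ext fun x => hs (Submodule.mem_top (x := x))

lemma opWord_mem (M : Fin n → (H2 n →L[ℂ] H2 n)) {X : Fin n → (H2 n →L[ℂ] H2 n)}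
    (hX : ∀ i, X i ∈ cstar M) (α : FreeMonoid (Fin n)) : opWord X α ∈ cstar M := by
  have : opWord X α = ((FreeMonoid.lift (fun i => (⟨X i, hX i⟩ : cstar M)) α : cstar M) :
      H2 n →L[ℂ] H2 n) := by
    have h : FreeMonoid.lift X = ((cstar M).subtype : cstar M →* (H2 n →L[ℂ] H2 n)).comp
        (FreeMonoid.lift (fun i => (⟨X i, hX i⟩ : cstar M))) :=
      FreeMonoid.hom_eq fun i => by simp
    exact DFunLike.congr_fun h α
  rw [this]
  exact Subtype.property _

lemma partialSum_mem (M : Fin n → (H2 n →L[ℂ] H2 n)) {X : Fin n → (H2 n →L[ℂ] H2 n)}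
    (hX : ∀ i, X i ∈ cstar M) (a : NCSeries n) (m : ℕ) : partialSum a X m ∈ cstar M :=
  sum_mem fun _ _ => sum_mem fun _ _ => (cstar M).smul_mem (opWord_mem M hX _) _

lemma starRep_lift (π : StarRep M K) (h1 : π 1 = 1) (X : Fin n → cstar M)
    (α : FreeMonoid (Fin n)) : π (FreeMonoid.lift X α) = opWord (fun i => π (X i)) α := by
  induction α using FreeMonoid.recOn with
  | one => simpa [opWord] using h1
  | of_mul i α ih => simp [opWord, ih, map_mul] at ih ⊢

lemma opWord_coe (X : Fin n → cstar M) (α : FreeMonoid (Fin n)) :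
    ((FreeMonoid.lift X α : cstar M) : H2 n →L[ℂ] H2 n) = opWord (fun i => (X i : _)) α := by
  induction α using FreeMonoid.recOn with
  | one => simp [opWord]
  | of_mul i α ih => simp [opWord] at ih ⊢; rw [ih]

lemma starRep_partialSum (π : StarRep M K) (h1 : π 1 = 1) (X : Fin n → cstar M) (a : NCSeries n)
    (m : ℕ) (h : partialSum a (fun i => (X i : H2 n →L[ℂ] H2 n)) m ∈ cstar M) :
    π ⟨_, h⟩ = partialSum a (fun i => π (X i)) m := by
  have : (⟨_, h⟩ : cstar M) =
      ∑ k ∈ Finset.range m, ∑ w : Fin k → Fin n, a (word w) • FreeMonoid.lift X (word w) := by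
    apply Subtype.ext
    simp [partialSum, opWord_coe]
  rw [this]
  simp [partialSum, starRep_lift π h1]

lemma NormSum.mem_cstar {a : NCSeries n} {X : Fin n → (H2 n →L[ℂ] H2 n)}
    (hX : ∀ i, X i ∈ cstar M) {T : H2 n →L[ℂ] H2 n} (h : NormSum a X T) : T ∈ cstar M :=
  (isClosed_cstar M).mem_of_tendsto h (Eventually.of_forall fun m => partialSum_mem M hX a m)

lemma NormSum.map {a : NCSeries n} (X : Fin n → cstar M) {T : H2 n →L[ℂ] H2 n}
    (h : NormSum a (fun i => (X i : H2 n →L[ℂ] H2 n)) T) (hT : T ∈ cstar M)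
    (π : StarRep M K) (h1 : π 1 = 1) : NormSum a (fun i => π (X i)) (π ⟨T, hT⟩) := by
  have h2 : Tendsto (fun m => (⟨_, partialSum_mem M (fun i => (X i).2) a m⟩ : cstar M)) atTop
      (𝓝 ⟨T, hT⟩) := tendsto_subtype_rng.2 h
  have h3 := ((continuous_starRep π).tendsto _).comp h2
  refine h3.congr fun m => ?_
  exact starRep_partialSum π h1 X a m _

lemma HasNormEval.mem_cstar {a : NCSeries n} {T : H2 n →L[ℂ] H2 n} (h : HasNormEval a M T) :
    T ∈ cstar M := by
  rcases h with h | ⟨δ, hδ, F, hF, hT⟩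
  · exact h.mem_cstar (gen_mem M)
  · refine (isClosed_cstar M).mem_of_tendsto hT ?_
    filter_upwards [Ioo_mem_nhdsLT hδ.2] with r hr
    exact (hF r hr).mem_cstar fun i => (cstar M).smul_mem (gen_mem M i) _

lemma HasNormEval.map {a : NCSeries n} {T : H2 n →L[ℂ] H2 n} (h : HasNormEval a M T)
    (hT : T ∈ cstar M) (π : StarRep M K) (h1 : π 1 = 1) :
    HasNormEval a (repTuple π) (π ⟨T, hT⟩) := by
  rcases h with h | ⟨δ, hδ, F, hF, hTF⟩
  · exact Or.inl (NormSum.map (gen M) h hT π h1)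
  · right
    have hmem : ∀ r ∈ Ioo δ 1, F r ∈ cstar M := fun r hr =>
      (hF r hr).mem_cstar fun i => (cstar M).smul_mem (gen_mem M i) _
    classical
    -- The sums `F r` are known to lie in `cstar M` only for `r` in `(δ, 1)`; the value `0`
    -- elsewhere does not affect the limit at `1`.
    refine ⟨δ, hδ, fun r => if hr : r ∈ Ioo δ 1 then π ⟨F r, hmem r hr⟩ else 0, fun r hr => ?_, ?_⟩
    · have := NormSum.map (fun i => (r : ℂ) • gen M i) (hF r hr) (hmem r hr) π h1
      have e : (fun i => π ((r : ℂ) • gen M i)) = fun i => (r : ℂ) • repTuple π i :=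
        funext fun i => map_smul π _ _
      simpa only [dif_pos hr, e] using this
    · have h2 : Tendsto (fun r => if hr : r ∈ Ioo δ 1 then (⟨F r, hmem r hr⟩ : cstar M) else 0)
          (𝓝[<] 1) (𝓝 ⟨T, hT⟩) := by
        refine tendsto_subtype_rng.2 (hTF.congr' ?_)
        filter_upwards [Ioo_mem_nhdsLT hδ.2] with r hr
        simp only [dif_pos hr]
      refine (((continuous_starRep π).tendsto _).comp h2).congr fun r => ?_
      by_cases hr : r ∈ Ioo δ 1 <;>
        simp only [Function.comp, dif_pos, dif_neg, hr, not_false_eq_true, map_zero]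

end Image

/-! ### Creation operators and the vacuum projection -/

section Creation

variable {n : ℕ}

/-- The basis vector of `ℍ²(f)` that stands for `f_α`. -/
def basisVec (α : FreeMonoid (Fin n)) : H2 n := lp.single 2 α (1 : ℂ)

lemma inner_basisVec (α : FreeMonoid (Fin n)) (c : H2 n) : ⟪basisVec α, c⟫_ℂ = c α := by
  simp [basisVec, lp.inner_single_left]

lemma basisVec_apply (α β : FreeMonoid (Fin n)) :
    (basisVec α : H2 n) β = if β = α then 1 else 0 := by
  simp [basisVec, lp.single_apply, Pi.single_apply]

lemma orthonormal_basisVec : Orthonormal ℂ (basisVec (n := n)) := by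
  rw [orthonormal_iff_ite]
  intro α β
  rw [inner_basisVec, basisVec_apply]

lemma lp_single_eq_smul (α : FreeMonoid (Fin n)) (r : ℂ) :
    (lp.single 2 α r : H2 n) = r • basisVec α := by
  rw [basisVec, ← lp.single_smul]; simp

lemma finVec_eq_sum (c : FreeMonoid (Fin n) →₀ ℂ) : finVec c = c.sum fun α r => r • basisVec α := by
  simp only [finVec, lp_single_eq_smul]

lemma finVec_eq_linearCombination (c : FreeMonoid (Fin n) →₀ ℂ) :
    finVec c = Finsupp.linearCombination ℂ basisVec c := by
  rw [finVec_eq_sum, Finsupp.linearCombination_apply]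

lemma finVec_single (α : FreeMonoid (Fin n)) (r : ℂ) :
    finVec (Finsupp.single α r) = r • basisVec α := by
  simp [finVec_eq_linearCombination]

lemma span_basisVec_closure :
    (Submodule.span ℂ (Set.range (basisVec (n := n)))).topologicalClosure = ⊤ := by
  rw [Submodule.topologicalClosure_eq_top_iff, Submodule.eq_bot_iff]
  intro c hc
  ext α
  rw [← inner_basisVec]
  exact (Submodule.mem_orthogonal _ _).1 hc _ (Submodule.subset_span ⟨α, rfl⟩)

/-- Bounded operators agreeing on a set that spans a dense subspace are equal. -/
lemma clm_ext_of_span_dense {E F : Type*} [NormedAddCommGroup E] [NormedSpace ℂ E]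
    [NormedAddCommGroup F] [NormedSpace ℂ F] {s : Set E}
    (hs : (Submodule.span ℂ s).topologicalClosure = ⊤) {T T' : E →L[ℂ] F}
    (h : ∀ x ∈ s, T x = T' x) : T = T' := by
  exact ContinuousLinearMap.ext_on (Submodule.dense_iff_topologicalClosure_eq_top.2 hs) h

lemma clm_ext_basisVec {F : Type*} [NormedAddCommGroup F] [NormedSpace ℂ F]
    {T T' : H2 n →L[ℂ] F} (h : ∀ α, T (basisVec α) = T' (basisVec α)) : T = T' :=
  clm_ext_of_span_dense span_basisVec_closure (by rintro _ ⟨α, rfl⟩; exact h α)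

lemma orthonormal_basisVec_of_mul (j : Fin n) :
    Orthonormal ℂ fun α => basisVec (FreeMonoid.of j * α) :=
  orthonormal_basisVec.comp _ fun _ _ h => mul_left_cancel h

/-- The left creation operator `f_α ↦ f_j f_α`. -/
def creation (j : Fin n) : H2 n →L[ℂ] H2 n :=
  (orthonormal_basisVec_of_mul j).orthogonalFamily.linearIsometry.toContinuousLinearMap

lemma creation_basisVec (j : Fin n) (α : FreeMonoid (Fin n)) :
    creation j (basisVec α) = basisVec (FreeMonoid.of j * α) := by
  simp [creation, basisVec, OrthogonalFamily.linearIsometry_apply_single]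

lemma creation_inner (j : Fin n) (c d : H2 n) : ⟪creation j c, creation j d⟫_ℂ = ⟪c, d⟫_ℂ :=
  LinearIsometry.inner_map_map _ c d

lemma creation_apply_of_mul (j : Fin n) (c : H2 n) (α : FreeMonoid (Fin n)) :
    creation j c (FreeMonoid.of j * α) = c α := by
  rw [← inner_basisVec, ← creation_basisVec, creation_inner, inner_basisVec]

lemma creation_apply_of_ne (j : Fin n) (c : H2 n) (β : FreeMonoid (Fin n))
    (h : ∀ α, β ≠ FreeMonoid.of j * α) : creation j c β = 0 := by
  have : (innerSL ℂ (basisVec β)) ∘L creation j = 0 := clm_ext_basisVec fun α => by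
    simp [creation_basisVec, inner_basisVec, basisVec_apply, h α]
  have := DFunLike.congr_fun this c
  simpa [inner_basisVec] using this

lemma creation_apply_one (j : Fin n) (c : H2 n) : creation j c 1 = 0 :=
  creation_apply_of_ne j c 1 fun α h => by
    have := congrArg FreeMonoid.length h
    rw [FreeMonoid.length_one, FreeMonoid.length_mul, FreeMonoid.length_of] at this
    omega

lemma creation_apply_of_mul_eq_ite (i j : Fin n) (c : H2 n) (α : FreeMonoid (Fin n)) :
    creation j c (FreeMonoid.of i * α) = if i = j then c α else 0 := by
  split_ifs with h
  · rw [h, creation_apply_of_mul]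
  · refine creation_apply_of_ne _ _ _ fun α' h' => h ?_
    have := congrArg FreeMonoid.toList h'
    simp at this
    exact this.1

lemma adjoint_creation_basisVec_one (j : Fin n) :
    star (creation j) (basisVec (1 : FreeMonoid (Fin n))) = 0 := by
  ext α
  rw [← inner_basisVec, ContinuousLinearMap.star_eq_adjoint,
    ContinuousLinearMap.adjoint_inner_right, creation_basisVec, inner_basisVec, basisVec_apply,
    if_neg]
  · rfl
  · intro h
    have := congrArg FreeMonoid.length h
    simp at this

lemma adjoint_creation_basisVec_mul (i j : Fin n) (β : FreeMonoid (Fin n)) :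
    star (creation j) (basisVec (FreeMonoid.of i * β)) = if i = j then basisVec β else 0 := by
  ext α
  rw [← inner_basisVec, ContinuousLinearMap.star_eq_adjoint,
    ContinuousLinearMap.adjoint_inner_right, creation_basisVec, inner_basisVec, basisVec_apply]
  have : FreeMonoid.of j * α = FreeMonoid.of i * β ↔ i = j ∧ α = β := by
    constructor
    · intro h
      have := congrArg FreeMonoid.toList h
      simp at this
      exact ⟨this.1.symm, this.2⟩
    · rintro ⟨rfl, rfl⟩; rfl
  by_cases h : i = j <;> simp [this, h, basisVec_apply]

/-- The rank one operator `z ↦ ⟨y, z⟩ x`. -/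
abbrev ketBra (x y : H2 n) : H2 n →L[ℂ] H2 n := InnerProductSpace.rankOne ℂ x y

/-- The creation operators are isometries with pairwise orthogonal ranges, and every nonempty word
begins with exactly one letter, so only the vacuum is left over. -/
lemma one_sub_sum_creation :
    1 - ∑ j, creation j * star (creation j) =
      ketBra (basisVec (1 : FreeMonoid (Fin n))) (basisVec 1) := by
  refine clm_ext_basisVec fun α => ?_
  induction α using FreeMonoid.casesOn with
  | one =>
    have h1 : ‖basisVec (1 : FreeMonoid (Fin n))‖ = 1 := orthonormal_basisVec.1 1
    simp [adjoint_creation_basisVec_one, h1]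
  | of_mul i α =>
    have h1 : (1 : FreeMonoid (Fin n)) ≠ FreeMonoid.of i * α := fun h => by
      have := congrArg FreeMonoid.length h
      rw [FreeMonoid.length_one, FreeMonoid.length_mul, FreeMonoid.length_of] at this
      omega
    simp [adjoint_creation_basisVec_mul, inner_basisVec, basisVec_apply, h1, apply_ite,
      creation_basisVec]

end Creation

/-! ### Sums over words -/

section Words

variable {n : ℕ}

lemma length_word {k : ℕ} (w : Fin k → Fin n) : (word w).toList.length = k := by
  simp [word]

lemma word_injective (k : ℕ) : Function.Injective (word (n := n) (k := k)) := fun v w h => by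
  simpa [word] using h

lemma exists_word (α : FreeMonoid (Fin n)) : ∃ w : Fin α.toList.length → Fin n, word w = α :=
  ⟨α.toList.get, by simp [word]⟩

lemma word_zero (w : Fin 0 → Fin n) : word w = 1 := by
  simp [word]

lemma word_cons {k : ℕ} (i : Fin n) (w : Fin k → Fin n) :
    word (Fin.cons i w : Fin (k + 1) → Fin n) = FreeMonoid.of i * word w := by
  simp [word, List.ofFn_succ]

lemma sum_word_succ {E : Type*} [AddCommMonoid E] {k : ℕ} (F : FreeMonoid (Fin n) → E) :
    ∑ w : Fin (k + 1) → Fin n, F (word w) =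
      ∑ i, ∑ w : Fin k → Fin n, F (FreeMonoid.of i * word w) := by
  rw [← (Fin.consEquiv fun _ : Fin (k + 1) => Fin n).sum_comp, Fintype.sum_prod_type]
  exact Finset.sum_congr rfl fun i _ => Finset.sum_congr rfl fun w _ => by
    rw [← word_cons]; rfl

lemma sum_word_zero {E : Type*} [AddCommMonoid E] (F : FreeMonoid (Fin n) → E) :
    ∑ w : Fin 0 → Fin n, F (word w) = F 1 := by
  simp [word_zero]

lemma opWord_one {K : Type*} [NormedAddCommGroup K] [InnerProductSpace ℂ K]
    (X : Fin n → (K →L[ℂ] K)) : opWord X 1 = 1 := by simp [opWord]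

lemma opWord_of_mul {K : Type*} [NormedAddCommGroup K] [InnerProductSpace ℂ K]
    (X : Fin n → (K →L[ℂ] K)) (i : Fin n) (α : FreeMonoid (Fin n)) :
    opWord X (FreeMonoid.of i * α) = X i * opWord X α := by simp [opWord]

/-- The evaluation of a polynomial is a finite sum. -/
lemma partialSum_finsupp {K : Type*} [NormedAddCommGroup K] [InnerProductSpace ℂ K]
    (c : FreeMonoid (Fin n) →₀ ℂ) (X : Fin n → (K →L[ℂ] K)) (m : ℕ)
    (hm : ∀ α ∈ c.support, α.toList.length < m) :
    partialSum (fun α => c α) X m = c.sum fun α r => r • opWord X α := by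
  classical
  have key : ∀ k (F : FreeMonoid (Fin n) → K →L[ℂ] K), (∀ α, α ∉ c.support → F α = 0) →
      ∑ w : Fin k → Fin n, F (word w) = ∑ α ∈ c.support with α.toList.length = k, F α := by
    intro k F hF
    rw [← Finset.sum_image (f := F) (fun v _ w _ h => word_injective k h)]
    refine (Finset.sum_subset ?_ ?_).symm
    · intro α hα
      obtain ⟨hα, rfl⟩ := Finset.mem_filter.1 hα
      obtain ⟨w, hw⟩ := exists_word α
      exact Finset.mem_image.2 ⟨w, Finset.mem_univ _, hw⟩
    · intro α hα hα'
      obtain ⟨w, -, rfl⟩ := Finset.mem_image.1 hα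
      refine hF _ fun h => hα' (Finset.mem_filter.2 ⟨h, length_word w⟩)
  rw [partialSum, Finsupp.sum]
  rw [Finset.sum_congr rfl fun k _ => key k (fun α => c α • opWord X α) fun α hα => by
    rw [Finsupp.notMem_support_iff.1 hα, zero_smul]]
  exact Finset.sum_fiberwise_of_maps_to (fun α hα => Finset.mem_range.2 (hm α hα)) _

end Words

/-! ### The polynomial case: `f_j(M_Z)` is a creation operator -/

section PolynomialModel

variable {n : ℕ}

lemma polyComb_eq_linearCombination (p : Fin n → FreeAlgebra ℂ (Fin n))
    (c : FreeMonoid (Fin n) →₀ ℂ) :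
    polyComb p c = Finsupp.linearCombination ℂ (FreeMonoid.lift p) c := by
  rw [Finsupp.linearCombination_apply, polyComb]

lemma polyComb_ι (u : FreeAlgebra ℂ (Fin n)) :
    u = polyComb (FreeAlgebra.ι ℂ) (FreeAlgebra.equivMonoidAlgebraFreeMonoid u).coeff := by
  conv_lhs => rw [← FreeAlgebra.equivMonoidAlgebraFreeMonoid.symm_apply_apply u]
  exact MonoidAlgebra.lift_apply _ _

lemma equiv_polyComb_ι (c : FreeMonoid (Fin n) →₀ ℂ) :
    FreeAlgebra.equivMonoidAlgebraFreeMonoid (polyComb (FreeAlgebra.ι ℂ) c) =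
      MonoidAlgebra.ofCoeff c := by
  rw [← AlgEquiv.eq_symm_apply]
  exact (MonoidAlgebra.lift_apply _ _).symm

lemma map_polyComb {A : Type*} [Semiring A] [Algebra ℂ A] (φ : FreeAlgebra ℂ (Fin n) →ₐ[ℂ] A)
    (p : Fin n → FreeAlgebra ℂ (Fin n)) (c : FreeMonoid (Fin n) →₀ ℂ) :
    φ (polyComb p c) = c.sum fun α r => r • FreeMonoid.lift (fun i => φ (p i)) α := by
  have : ∀ α, φ (FreeMonoid.lift p α) = FreeMonoid.lift (fun i => φ (p i)) α := fun α => by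
    have h : (φ : FreeAlgebra ℂ (Fin n) →* A).comp (FreeMonoid.lift p) =
        FreeMonoid.lift (fun i => φ (p i)) := FreeMonoid.hom_eq fun i => by simp
    exact DFunLike.congr_fun h α
  simp [polyComb, Finsupp.sum, this]

/-- Substituting the inverse tuple turns each `p_α` into `Z_α`, and the words form a basis of the
free algebra. -/
lemma PolyInvertible.polyComb_injective {p : Fin n → FreeAlgebra ℂ (Fin n)}
    (hp : PolyInvertible p) : Function.Injective (polyComb p) := by
  obtain ⟨q, hq⟩ := hp
  intro c d h
  have h1 : ∀ c, FreeAlgebra.lift ℂ q (polyComb p c) = polyComb (FreeAlgebra.ι ℂ) c := fun c => by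
    rw [map_polyComb, polyComb]
    simp only [(hq _).1]
  have h2 : polyComb (FreeAlgebra.ι ℂ) c = polyComb (FreeAlgebra.ι ℂ) d := by
    rw [← h1, ← h1, h]
  have h3 := congrArg FreeAlgebra.equivMonoidAlgebraFreeMonoid h2
  rw [equiv_polyComb_ι, equiv_polyComb_ι] at h3
  exact congrArg MonoidAlgebra.coeff h3

lemma isMulPoly_lift {p : Fin n → FreeAlgebra ℂ (Fin n)} {M : Fin n → (H2 n →L[ℂ] H2 n)}
    (h : ∀ i, IsMulPoly p (FreeAlgebra.ι ℂ i) (M i)) (u : FreeAlgebra ℂ (Fin n)) :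
    IsMulPoly p u (FreeAlgebra.lift ℂ M u) := by
  induction u using FreeAlgebra.induction with
  | grade0 r =>
    intro c
    refine ⟨r • c, ?_, ?_⟩
    · simp [polyComb_eq_linearCombination, Algebra.smul_def]
    · rw [AlgHom.commutes, finVec_eq_linearCombination, finVec_eq_linearCombination, map_smul,
        Algebra.algebraMap_eq_smul_one]
      rfl
  | grade1 i => simpa using h i
  | mul u v hu hv =>
    intro c
    obtain ⟨d, hd, hd'⟩ := hv c
    obtain ⟨e, he, he'⟩ := hu d
    refine ⟨e, by rw [he, hd, mul_assoc], ?_⟩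
    rw [map_mul, mul_apply_eq_comp, hd', he']
  | add u v hu hv =>
    intro c
    obtain ⟨d, hd, hd'⟩ := hv c
    obtain ⟨e, he, he'⟩ := hu c
    refine ⟨e + d, ?_, ?_⟩
    · rw [add_mul, ← hd, ← he]
      simp [polyComb_eq_linearCombination]
    · rw [map_add, _root_.add_apply, hd', he']
      simp [finVec_eq_linearCombination]

/-- Multiplication by `p_j` sends `p_α` to `p_j p_α`, whose expansion in the `p_β` is unique. The
series of `f_j` is finite, so its partial sums are eventually constant. -/
lemma ModelA.hasWeakEval {f : Fin n → NCSeries n} {M : Fin n → (H2 n →L[ℂ] H2 n)}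
    (h : ModelA f M) (j : Fin n) : HasWeakEval (f j) M (creation j) := by
  obtain ⟨p, hf, hp, hM⟩ := h
  have h1 : FreeAlgebra.lift ℂ M (p j) = creation j := by
    refine clm_ext_basisVec fun α => ?_
    obtain ⟨d, hd, hd'⟩ := isMulPoly_lift hM (p j) (Finsupp.single α 1)
    have : d = Finsupp.single (FreeMonoid.of j * α) 1 := hp.polyComb_injective <| by
      rw [hd]
      simp [polyComb_eq_linearCombination]
    rw [finVec_single, one_smul] at hd'
    rw [hd', this, finVec_single, one_smul, creation_basisVec]
  left
  refine (SOTSum.weakSum (NormSum.sotSum ?_))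
  have h2 : f j = fun α => (FreeAlgebra.equivMonoidAlgebraFreeMonoid (p j)).coeff α :=
    funext (hf j)
  set c := (FreeAlgebra.equivMonoidAlgebraFreeMonoid (p j)).coeff
  have h3 : c.sum (fun α r => r • opWord M α) = creation j := by
    rw [← h1, polyComb_ι (p j), map_polyComb]
    simp [opWord, c]
  rw [h2]
  refine tendsto_atTop_of_eventually_const (i₀ := c.support.sup (fun α => α.toList.length) + 1)
    fun m hm => ?_
  rw [partialSum_finsupp, h3]
  intro α hα
  exact lt_of_lt_of_le (Nat.lt_succ_of_le (Finset.le_sup (f := fun α => α.toList.length) hα)) hm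

end PolynomialModel

/-! ### The formal power series case -/

section FormalModel

variable {n : ℕ}

lemma wordProd_one (f : Fin n → NCSeries n) : wordProd f 1 = mono 1 := rfl

lemma wordProd_of_mul (f : Fin n → NCSeries n) (i : Fin n) (α : FreeMonoid (Fin n)) :
    wordProd f (FreeMonoid.of i * α) = cauchyMul (f i) (wordProd f α) := rfl

/-- As `f(0) = 0`, each factor of `f_α` contributes degree at least one. -/
lemma wordProd_eq_zero {f : Fin n → NCSeries n} (h0 : ∀ i, f i 1 = 0)
    (α β : FreeMonoid (Fin n)) (h : β.toList.length < α.toList.length) : wordProd f α β = 0 := by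
  induction α using FreeMonoid.recOn generalizing β with
  | one => simp at h
  | of_mul i α ih =>
    rw [wordProd_of_mul, cauchyMul]
    refine Finset.sum_eq_zero fun l hlr => ?_
    rw [Finset.mem_range] at hlr
    rcases Nat.eq_zero_or_pos l with rfl | hl
    · have : f i (FreeMonoid.ofList (β.toList.take 0)) = 0 := h0 i
      rw [this, zero_mul]
    · rw [ih, mul_zero]
      rw [FreeMonoid.toList_of_mul, List.length_cons] at h
      rw [FreeMonoid.toList_ofList, List.length_drop]
      omega

/-- The lowest degree part of `f_α` is the product of the linear parts of its factors: in degree `k`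
the matrix is the `k`-th tensor power of the Jacobian. -/
lemma wordProd_word_word {f : Fin n → NCSeries n} (h0 : ∀ i, f i 1 = 0) {k : ℕ}
    (w v : Fin k → Fin n) : wordProd f (word w) (word v) = ∏ i, jacobian f (w i) (v i) := by
  induction k with
  | zero => simp [word_zero, wordProd_one, mono]
  | succ k ih =>
    rw [← Fin.cons_self_tail w, ← Fin.cons_self_tail v, word_cons, word_cons, wordProd_of_mul,
      cauchyMul, Fin.prod_univ_succ]
    simp only [Fin.cons_zero, Fin.cons_succ]
    -- Only the cut after the first letter survives: the empty cut meets `f(0) = 0`, and a longer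
    -- one leaves too short a word for the remaining factors.
    rw [← ih, Finset.sum_eq_single 1]
    · simp [jacobian]
    · intro l hlr hl
      rw [Finset.mem_range, FreeMonoid.toList_of_mul, List.length_cons, length_word] at hlr
      rcases Nat.eq_zero_or_pos l with rfl | hl'
      · rw [List.take_zero]
        have : f (w 0) (FreeMonoid.ofList []) = 0 := h0 _
        rw [this, zero_mul]
      · rw [wordProd_eq_zero h0, mul_zero]
        rw [length_word, FreeMonoid.toList_ofList, List.length_drop, FreeMonoid.toList_of_mul,
          List.length_cons, length_word]
        omega
    · intro h
      simp at h

/-- Summands of high degree do not contribute to a coefficient of `∑ c_α f_α`. -/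
lemma formalComb_eq {f : Fin n → NCSeries n} (h0 : ∀ i, f i 1 = 0) (c : H2 n)
    (β : FreeMonoid (Fin n)) {N : ℕ} (hN : β.toList.length < N) :
    formalComb f c β = ∑ k ∈ Finset.range N, ∑ w : Fin k → Fin n,
      c (word w) * wordProd f (word w) β := by
  refine Finset.sum_subset (Finset.range_mono hN) fun k _ hk => ?_
  refine Finset.sum_eq_zero fun w _ => ?_
  rw [wordProd_eq_zero h0, mul_zero]
  rw [length_word]
  simpa using hk

lemma formalComb_sub (f : Fin n → NCSeries n) (c d : H2 n) :
    formalComb f (c - d) = formalComb f c - formalComb f d := by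
  funext β
  simp [formalComb, sub_mul]

lemma formalComb_creation {f : Fin n → NCSeries n} (h0 : ∀ i, f i 1 = 0) (j : Fin n) (c : H2 n) :
    formalComb f (creation j c) = cauchyMul (f j) (formalComb f c) := by
  funext β
  have h1 : ∀ l, formalComb f c (FreeMonoid.ofList (β.toList.drop l)) =
      ∑ k ∈ Finset.range (β.toList.length + 1), ∑ w : Fin k → Fin n,
        c (word w) * wordProd f (word w) (FreeMonoid.ofList (β.toList.drop l)) := fun l =>
    formalComb_eq h0 c _ (by simp)
  -- The truncation is taken one degree beyond the default, so that removing the empty word and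
  -- shifting by one letter leaves exactly the range used in `h1`.
  rw [formalComb_eq h0 _ β (Nat.lt_succ_of_lt (Nat.lt_succ_self _)), Finset.sum_range_succ',
    sum_word_zero (fun α => creation j c α * wordProd f α β),
    creation_apply_one, zero_mul, add_zero, cauchyMul]
  simp only [h1, Finset.mul_sum]
  rw [Finset.sum_comm]
  refine Finset.sum_congr rfl fun k _ => ?_
  rw [Finset.sum_comm, sum_word_succ (fun α => creation j c α * wordProd f α β)]
  simp only [creation_apply_of_mul_eq_ite, ite_mul, zero_mul]
  rw [Finset.sum_comm]
  refine Finset.sum_congr rfl fun w _ => ?_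
  rw [Finset.sum_ite_eq' Finset.univ j, if_pos (Finset.mem_univ _), wordProd_of_mul, cauchyMul,
    Finset.mul_sum]
  exact Finset.sum_congr rfl fun l _ => by ring

/-- Induction on the degree: once the lower coefficients vanish, those of degree `k` solve a
homogeneous system whose matrix is the `k`-th tensor power of the invertible Jacobian. -/
lemma eq_zero_of_formalComb_eq_zero {f : Fin n → NCSeries n} (h0 : ∀ i, f i 1 = 0)
    (hJ : (jacobian f).det ≠ 0) {c : H2 n} (hc : formalComb f c = 0) : c = 0 := by
  have key : ∀ k (u : Fin k → Fin n), c (word u) = 0 := by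
    intro k
    induction k using Nat.strong_induction_on with
    | _ k ih =>
      intro u
      have h1 : ∀ v : Fin k → Fin n,
          ∑ w : Fin k → Fin n, c (word w) * ∏ i, jacobian f (w i) (v i) = 0 := fun v => by
        have h2 := congrFun hc (word v)
        rw [formalComb, length_word, Finset.sum_range_succ, Finset.sum_eq_zero, zero_add] at h2
        · simpa [wordProd_word_word h0] using h2
        · intro l hl
          refine Finset.sum_eq_zero fun w _ => ?_
          rw [ih l (Finset.mem_range.1 hl), zero_mul]
      have hJ' : jacobian f * (jacobian f)⁻¹ = 1 :=
        Matrix.mul_nonsing_inv _ (isUnit_iff_ne_zero.2 hJ)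
      -- The tensor power of the inverse Jacobian inverts the tensor power of the Jacobian.
      have h3 : ∀ w : Fin k → Fin n, ∑ v : Fin k → Fin n,
          (∏ i, jacobian f (w i) (v i)) * ∏ i, (jacobian f)⁻¹ (v i) (u i) =
            if w = u then 1 else 0 := fun w => by
        have h4 := Finset.prod_univ_sum (fun _ : Fin k => (Finset.univ : Finset (Fin n)))
          fun i x => jacobian f (w i) x * (jacobian f)⁻¹ x (u i)
        rw [Fintype.piFinset_univ] at h4
        simp only [← Finset.prod_mul_distrib]
        rw [← h4]
        simp only [← Matrix.mul_apply, hJ', Matrix.one_apply]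
        by_cases h : w = u
        · simp [h]
        · obtain ⟨i, hi⟩ := Function.ne_iff.1 h
          rw [if_neg h]
          exact Finset.prod_eq_zero (Finset.mem_univ i) (if_neg hi)
      calc c (word u) = ∑ w : Fin k → Fin n, c (word w) * (if w = u then 1 else 0) := by simp
        _ = ∑ v : Fin k → Fin n, (∑ w : Fin k → Fin n, c (word w) *
              ∏ i, jacobian f (w i) (v i)) * ∏ i, (jacobian f)⁻¹ (v i) (u i) := by
            simp only [← h3, Finset.mul_sum, Finset.sum_mul]
            rw [Finset.sum_comm]
            exact Finset.sum_congr rfl fun v _ => Finset.sum_congr rfl fun w _ => by ring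
        _ = 0 := by simp [h1]
  ext α
  obtain ⟨w, hw⟩ := exists_word α
  rw [← hw, key]
  rfl

lemma ModelS.eq_creation {f : Fin n → NCSeries n} {M : Fin n → (H2 n →L[ℂ] H2 n)}
    (h : ModelS f M) {j : Fin n} {T : H2 n →L[ℂ] H2 n} (hT : IsMulFormal f (f j) T) :
    T = creation j := by
  ext1 c
  refine sub_eq_zero.1 (eq_zero_of_formalComb_eq_zero h.map_zero h.jacobian_ne ?_)
  rw [formalComb_sub, hT, formalComb_creation h.map_zero, sub_self]

lemma ModelS.hasWeakEval {f : Fin n → NCSeries n} {M : Fin n → (H2 n →L[ℂ] H2 n)}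
    (h : ModelS f M) (j : Fin n) : HasWeakEval (f j) M (creation j) := by
  rcases h.eval with h' | h' <;> obtain ⟨T, hT, hT'⟩ := h' j <;> rw [← h.eq_creation hT']
  · exact Or.inl hT.weakSum
  · exact Or.inr hT.radWeakSum

end FormalModel

/-! ### The free holomorphic case -/

section HolomorphicModel

variable {n : ℕ} {K : Type*} [NormedAddCommGroup K] [InnerProductSpace ℂ K]

lemma NormSum.holEval_eq {a : NCSeries n} {X : Fin n → (K →L[ℂ] K)} {T : K →L[ℂ] K}
    (h : NormSum a X T) : holEval a X = T := Tendsto.limUnder_eq h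

lemma sum_norm_sq_word_le (c : H2 n) (k : ℕ) :
    ∑ w : Fin k → Fin n, ‖c (word w)‖ ^ 2 ≤ ‖c‖ ^ 2 := by
  have h := lp.sum_rpow_le_norm_rpow (p := 2) (by norm_num) c
    (Finset.univ.image (word (n := n) (k := k)))
  rw [Finset.sum_image fun v _ w _ h => word_injective k h] at h
  simpa using h

lemma partialSum_sub (a b : NCSeries n) (X : Fin n → (K →L[ℂ] K)) (m : ℕ) :
    partialSum (a - b) X m = partialSum a X m - partialSum b X m := by
  simp [partialSum, sub_smul]

lemma partialSum_creation (c : H2 n) (X : Fin n → (K →L[ℂ] K)) (j : Fin n) (m : ℕ) :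
    partialSum (fun α => creation j c α) X (m + 1) = X j * partialSum (fun α => c α) X m := by
  rw [partialSum, Finset.sum_range_succ',
    sum_word_zero (fun α => creation j c α • opWord X α),
    creation_apply_one, zero_smul, add_zero, partialSum,
    Finset.mul_sum]
  refine Finset.sum_congr rfl fun k _ => ?_
  rw [sum_word_succ (fun α => creation j c α • opWord X α), Finset.mul_sum, Finset.sum_comm]
  refine Finset.sum_congr rfl fun w _ => ?_
  simp [creation_apply_of_mul_eq_ite, ite_smul, opWord_of_mul]

variable [CompleteSpace K]

lemma sum_norm_sq_adjoint_le (Y : Fin n → (K →L[ℂ] K)) (x : K) :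
    ∑ i, ‖star (Y i) x‖ ^ 2 ≤ ‖∑ i, Y i * star (Y i)‖ * ‖x‖ ^ 2 := by
  have h1 : ((∑ i, ‖star (Y i) x‖ ^ 2 : ℝ) : ℂ) = ⟪x, (∑ i, Y i * star (Y i)) x⟫_ℂ := by
    rw [Complex.ofReal_sum, _root_.sum_apply, inner_sum]
    refine Finset.sum_congr rfl fun i _ => ?_
    rw [Complex.ofReal_pow, mul_apply_eq_comp, ← ContinuousLinearMap.adjoint_inner_left,
      ← ContinuousLinearMap.star_eq_adjoint, inner_self_eq_norm_sq_to_K]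
    rfl
  calc ∑ i, ‖star (Y i) x‖ ^ 2 = ‖((∑ i, ‖star (Y i) x‖ ^ 2 : ℝ) : ℂ)‖ := by
        rw [Complex.norm_real, Real.norm_of_nonneg (by positivity)]
    _ ≤ ‖x‖ * ‖(∑ i, Y i * star (Y i)) x‖ := by rw [h1]; exact norm_inner_le_norm _ _
    _ ≤ ‖x‖ * (‖∑ i, Y i * star (Y i)‖ * ‖x‖) := by gcongr; exact ContinuousLinearMap.le_opNorm _ _
    _ = _ := by ring

/-- Peeling off one letter at a time costs one factor of the squared row norm, with no factor
counting the words. -/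
lemma sum_norm_sq_adjoint_opWord_le (Y : Fin n → (K →L[ℂ] K)) (k : ℕ) (x : K) :
    ∑ w : Fin k → Fin n, ‖star (opWord Y (word w)) x‖ ^ 2 ≤
      ‖∑ i, Y i * star (Y i)‖ ^ k * ‖x‖ ^ 2 := by
  induction k generalizing x with
  | zero =>
    rw [sum_word_zero (fun α => ‖star (opWord Y α) x‖ ^ 2)]
    simp [opWord_one]
  | succ k ih =>
    rw [sum_word_succ (fun α => ‖star (opWord Y α) x‖ ^ 2)]
    simp only [opWord_of_mul, star_mul, mul_apply_eq_comp]
    calc _ ≤ ∑ i, ‖∑ i, Y i * star (Y i)‖ ^ k * ‖star (Y i) x‖ ^ 2 :=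
          Finset.sum_le_sum fun i _ => ih _
      _ ≤ ‖∑ i, Y i * star (Y i)‖ ^ k * (‖∑ i, Y i * star (Y i)‖ * ‖x‖ ^ 2) := by
          rw [← Finset.mul_sum]
          gcongr
          exact sum_norm_sq_adjoint_le Y x
      _ = _ := by ring

/-- Cauchy–Schwarz over the words of length `k` pairs the square summable coefficients with the
adjoint word operators. On the open unit ball the bound is geometric, so the series converges in
norm. -/
lemma norm_homPart_le (c : H2 n) (Y : Fin n → (K →L[ℂ] K)) (k : ℕ) :
    ‖homPart (fun α => c α) Y k‖ ≤ ‖c‖ * Real.sqrt ‖∑ i, Y i * star (Y i)‖ ^ k := by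
  refine ContinuousLinearMap.opNorm_le_of_re_inner_le (by positivity) fun y x hy hx => ?_
  have h1 : ⟪homPart (fun α => c α) Y k y, x⟫_ℂ =
      ∑ w : Fin k → Fin n, ⟪c (word w) • y, star (opWord Y (word w)) x⟫_ℂ := by
    rw [homPart, _root_.sum_apply, sum_inner]
    refine Finset.sum_congr rfl fun w _ => ?_
    rw [ContinuousLinearMap.star_eq_adjoint, ContinuousLinearMap.adjoint_inner_right, map_smul]
    rfl
  calc RCLike.re ⟪homPart (fun α => c α) Y k y, x⟫_ℂ
      ≤ ‖⟪homPart (fun α => c α) Y k y, x⟫_ℂ‖ := RCLike.re_le_norm _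
    _ ≤ ∑ w : Fin k → Fin n, ‖⟪c (word w) • y, star (opWord Y (word w)) x⟫_ℂ‖ := by
        rw [h1]
        exact norm_sum_le _ _
    _ ≤ ∑ w : Fin k → Fin n, ‖c (word w)‖ * ‖star (opWord Y (word w)) x‖ :=
        Finset.sum_le_sum fun w _ => (norm_inner_le_norm _ _).trans_eq (by
          rw [norm_smul, hy, mul_one])
    _ ≤ Real.sqrt (∑ w : Fin k → Fin n, ‖c (word w)‖ ^ 2) *
          Real.sqrt (∑ w : Fin k → Fin n, ‖star (opWord Y (word w)) x‖ ^ 2) :=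
        Real.sum_mul_le_sqrt_mul_sqrt _ _ _
    _ ≤ Real.sqrt (‖c‖ ^ 2) * Real.sqrt (‖∑ i, Y i * star (Y i)‖ ^ k) := by
        gcongr
        · exact sum_norm_sq_word_le c k
        · simpa [hx] using sum_norm_sq_adjoint_opWord_le Y k x
    _ = _ := by
        rw [Real.sqrt_sq (norm_nonneg _)]
        congr 1
        rw [Real.sqrt_eq_iff_mul_self_eq (by positivity)
          (by positivity), ← mul_pow, Real.mul_self_sqrt (norm_nonneg _)]

lemma exists_normSum_of_mem_opBall (c : H2 n) {Y : Fin n → (K →L[ℂ] K)} (hY : Y ∈ opBall n 1) :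
    ∃ T, NormSum (fun α => c α) Y T := by
  have h : Summable (homPart (fun α => c α) Y) := by
    refine Summable.of_norm_bounded ((summable_geometric_of_lt_one (Real.sqrt_nonneg _)
      (show Real.sqrt _ < 1 from hY)).mul_left ‖c‖) (norm_homPart_le c Y)
  exact ⟨_, h.hasSum.tendsto_sum_nat⟩

lemma holEval_sub {c d : H2 n} {Y : Fin n → (K →L[ℂ] K)} (hY : Y ∈ opBall n 1) :
    holEval (fun α => (c - d) α) Y = holEval (fun α => c α) Y - holEval (fun α => d α) Y := by
  obtain ⟨T, hT⟩ := exists_normSum_of_mem_opBall c hY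
  obtain ⟨T', hT'⟩ := exists_normSum_of_mem_opBall d hY
  rw [hT.holEval_eq, hT'.holEval_eq]
  refine NormSum.holEval_eq ((hT.sub hT').congr fun m => ?_)
  rw [← partialSum_sub]
  rfl

lemma holEval_creation (c : H2 n) {Y : Fin n → (K →L[ℂ] K)} (hY : Y ∈ opBall n 1) (j : Fin n) :
    holEval (fun α => creation j c α) Y = Y j * holEval (fun α => c α) Y := by
  obtain ⟨T, hT⟩ := exists_normSum_of_mem_opBall c hY
  rw [hT.holEval_eq]
  refine NormSum.holEval_eq ((tendsto_add_atTop_iff_nat 1).1 ?_)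
  simp only [partialSum_creation]
  exact hT.const_mul (Y j)

/-- Places square summable series among those to which `ModelF.not_zero_divisor` applies. -/
lemma invRadius_le_one (c : H2 n) : invRadius (fun α => c α) ≤ 1 := by
  -- The maximum with `1` keeps the base positive, so that its powers are continuous at exponent `0`
  -- even when `c = 0`.
  have h1 : Tendsto (fun k : ℕ => ENNReal.ofReal ((max (‖c‖ ^ 2) 1) ^ (1 / (2 * (k : ℝ))))) atTop
      (𝓝 1) := by
    have h2 : Tendsto (fun k : ℕ => 1 / (2 * (k : ℝ))) atTop (𝓝 0) := by
      have := (tendsto_one_div_atTop_nhds_zero_nat (𝕜 := ℝ)).const_mul (1 / 2)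
      simpa [mul_comm] using this
    have h3 := ((Real.continuous_const_rpow (a := max (‖c‖ ^ 2) 1)
      (by positivity)).tendsto 0).comp h2
    have := ENNReal.tendsto_ofReal h3
    simpa [Function.comp_def] using this
  rw [← h1.limsup_eq]
  refine limsup_le_limsup (Eventually.of_forall fun k => ?_)
  refine ENNReal.ofReal_le_ofReal (Real.rpow_le_rpow (by positivity) ?_ (by positivity))
  exact (sum_norm_sq_word_le c k).trans (le_max_left _ _)

/-- The coefficients of `T c - creation j c` define a `G` with `G ∘ f = 0` on the ball, hence `G =
0`. -/
lemma ModelF.eq_creation {γ : ℝ} {f : Fin n → NCSeries n} {M : Fin n → (H2 n →L[ℂ] H2 n)}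
    (h : ModelF γ f M) {j : Fin n} {T : H2 n →L[ℂ] H2 n} (hT : IsMulHol γ f (f j) T) :
    T = creation j := by
  ext1 c
  have h1 : (fun α => (T c - creation j c) α) = (0 : NCSeries n) := by
    refine h.not_zero_divisor _ (invRadius_le_one _) fun X hX => ?_
    have h2 := hT c X hX
    simp only [holComb] at h2
    rw [holEval_sub (h.range X hX), h2, holEval_creation c (h.range X hX), sub_self]
  refine sub_eq_zero.1 ?_
  ext α
  exact congrFun h1 α

lemma ModelF.hasWeakEval {γ : ℝ} {f : Fin n → NCSeries n} {M : Fin n → (H2 n →L[ℂ] H2 n)}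
    (h : ModelF γ f M) (j : Fin n) : HasWeakEval (f j) M (creation j) := by
  rcases h.eval with h' | h' <;> obtain ⟨T, hT, hT'⟩ := h' j <;> rw [← h.eq_creation hT']
  · exact Or.inl hT.weakSum
  · exact Or.inr hT.radWeakSum

end HolomorphicModel

lemma IsUniversalModel.hasWeakEval {n : ℕ} {f : Fin n → NCSeries n}
    {M : Fin n → (H2 n →L[ℂ] H2 n)} (h : IsUniversalModel f M) (j : Fin n) :
    HasWeakEval (f j) M (creation j) := by
  rcases h with h | h | ⟨γ, h⟩
  exacts [h.hasWeakEval j, h.hasWeakEval j, h.hasWeakEval j]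

/-- The universal model satisfies `f_j(M_Z) = M_{f_j}`. -/
lemma IsParallelModel.hasNormEval {n : ℕ} {f : Fin n → NCSeries n}
    {M : Fin n → (H2 n →L[ℂ] H2 n)} (h : IsParallelModel f M) (j : Fin n) :
    HasNormEval (f j) M (creation j) := by
  obtain ⟨T, hT⟩ : ∃ T, HasNormEval (f j) M T := by
    rcases h.2 with h' | h' <;> obtain ⟨T, hT⟩ := h' j
    exacts [⟨T, Or.inl hT⟩, ⟨T, Or.inr hT⟩]
  rwa [← hT.hasWeakEval.eq (h.1.hasWeakEval j)]

/-! ### Approximation of compact operators by finite rank operators -/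

section Compact

variable {n : ℕ}

lemma norm_sum_ketBra_apply_le (s : Finset (FreeMonoid (Fin n))) (v : H2 n) :
    ‖(∑ α ∈ s, ketBra (basisVec α) (basisVec α)) v‖ ≤ ‖v‖ := by
  have h1 : (∑ α ∈ s, ketBra (basisVec α) (basisVec α)) v =
      ∑ α ∈ s, ⟪basisVec α, v⟫_ℂ • basisVec α := by
    rw [_root_.sum_apply]
    rfl
  have h2 : ‖∑ α ∈ s, ⟪basisVec α, v⟫_ℂ • basisVec α‖ ^ 2 = ∑ α ∈ s, ‖⟪basisVec α, v⟫_ℂ‖ ^ 2 := by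
    rw [← Complex.ofReal_inj, Complex.ofReal_pow]
    have h3 := orthonormal_basisVec.inner_sum (fun α => ⟪basisVec α, v⟫_ℂ)
      (fun α => ⟪basisVec α, v⟫_ℂ) s
    rw [inner_self_eq_norm_sq_to_K] at h3
    refine h3.trans ?_
    rw [Complex.ofReal_sum]
    refine Finset.sum_congr rfl fun α _ => ?_
    rw [Complex.ofReal_pow]
    exact Complex.conj_mul' _
  rw [h1]
  refine pow_le_pow_iff_left₀ (norm_nonneg _) (norm_nonneg _) two_ne_zero |>.1 ?_
  rw [h2]
  exact orthonormal_basisVec.sum_inner_products_le v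

lemma tendsto_sum_ketBra_apply (v : H2 n) :
    Tendsto (fun s : Finset (FreeMonoid (Fin n)) =>
      (∑ α ∈ s, ketBra (basisVec α) (basisVec α)) v) atTop (𝓝 v) := by
  have h := lp.hasSum_single (p := 2) (by norm_num) v
  refine Tendsto.congr (fun s => ?_) h
  rw [_root_.sum_apply]
  refine Finset.sum_congr rfl fun α _ => ?_
  refine (lp_single_eq_smul α (v α)).trans ?_
  rw [InnerProductSpace.rankOne_apply, inner_basisVec]

/-- Compact operators are limits of operators of finite rank. -/
lemma mem_closure_span_ketBra {X : H2 n →L[ℂ] H2 n} (hX : IsCompactOperator X) :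
    X ∈ closure (Submodule.span ℂ {T : H2 n →L[ℂ] H2 n | ∃ x y, T = ketBra x y} :
      Set (H2 n →L[ℂ] H2 n)) := by
  rw [Metric.mem_closure_iff]
  intro ε hε
  obtain ⟨C, hC, hXC⟩ := hX.image_closedBall_subset_compact (𝕜₁ := ℂ) (f := X.toLinearMap) 1
  obtain ⟨t, -, ht, htC⟩ := hC.finite_cover_balls (show 0 < ε / 4 by positivity)
  -- A finite `ε/4`-net of the image of the unit ball is almost fixed by some basis projection `P`.
  -- As `P` is contractive, passing from `X v` to a net point costs three terms below `ε/4`.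
  have h1 : ∀ᶠ s : Finset (FreeMonoid (Fin n)) in atTop, ∀ y ∈ t,
      dist ((∑ α ∈ s, ketBra (basisVec α) (basisVec α)) y) y < ε / 4 :=
    (ht.eventually_all).2 fun y _ => Metric.tendsto_nhds.1 (tendsto_sum_ketBra_apply y) _
      (by positivity)
  obtain ⟨s, hs⟩ := h1.exists
  set P : H2 n →L[ℂ] H2 n := ∑ α ∈ s, ketBra (basisVec α) (basisVec α) with hP
  refine ⟨P * X, ?_, ?_⟩
  · rw [hP, Finset.sum_mul]
    refine Submodule.sum_mem _ fun α _ => Submodule.subset_span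
      ⟨basisVec α, ContinuousLinearMap.adjoint X (basisVec α), ?_⟩
    exact InnerProductSpace.rankOne_comp _ _ _
  · rw [dist_eq_norm]
    refine lt_of_le_of_lt (ContinuousLinearMap.opNorm_le_of_unit_norm (C := 3 * (ε / 4))
      (by positivity) fun v hv => ?_) (by linarith)
    obtain ⟨y, hy, hvy⟩ := mem_iUnion₂.1 (htC (hXC ⟨v, by simp [hv], rfl⟩))
    have h2 : (X - P * X) v = (X v - y) - P (X v - y) - (P y - y) := by
      rw [map_sub]
      change X v - P (X v) = _
      abel
    have h3 : ‖X v - y‖ < ε / 4 := by rw [← dist_eq_norm]; exact hvy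
    have h4 : ‖P y - y‖ < ε / 4 := by rw [← dist_eq_norm]; exact hs y hy
    have h5 : ‖P (X v - y)‖ ≤ ‖X v - y‖ := norm_sum_ketBra_apply_le s _
    rw [h2]
    refine (norm_sub_le _ _).trans ?_
    have := norm_sub_le (X v - y) (P (X v - y))
    linarith

end Compact

/-! ### The C*-algebra of the universal model contains the compacts -/

section Irreducible

variable {n : ℕ} {f : Fin n → NCSeries n} {M : Fin n → (H2 n →L[ℂ] H2 n)}

lemma partialSum_apply_mem {V : Submodule ℂ (H2 n)} {X : Fin n → (H2 n →L[ℂ] H2 n)}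
    (hX : ∀ i, ∀ v ∈ V, X i v ∈ V) (a : NCSeries n) (m : ℕ) {v : H2 n} (hv : v ∈ V) :
    partialSum a X m v ∈ V := by
  have h : ∀ α, opWord X α v ∈ V := fun α => by
    induction α using FreeMonoid.recOn with
    | one => simpa [opWord] using hv
    | of_mul i α ih =>
      rw [opWord_of_mul]
      exact hX i _ ih
  rw [partialSum, _root_.sum_apply]
  refine V.sum_mem fun k _ => ?_
  rw [_root_.sum_apply]
  exact V.sum_mem fun w _ => V.smul_mem _ (h _)

lemma HasNormEval.apply_mem {V : Submodule ℂ (H2 n)} (hV : IsClosed (V : Set (H2 n)))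
    (hM : ∀ i, ∀ v ∈ V, M i v ∈ V) {a : NCSeries n} {T : H2 n →L[ℂ] H2 n}
    (h : HasNormEval a M T) {v : H2 n} (hv : v ∈ V) : T v ∈ V := by
  rcases h with h | h
  · exact hV.mem_of_tendsto (h.sotSum v)
      (Eventually.of_forall fun m => partialSum_apply_mem hM a m hv)
  · obtain ⟨δ, hδ, F, hF, hT⟩ := h.radSOTSum
    refine hV.mem_of_tendsto (hT v) ?_
    filter_upwards [Ioo_mem_nhdsLT hδ.2] with r hr
    exact hV.mem_of_tendsto ((hF r hr).sotSum v) (Eventually.of_forall fun m =>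
      partialSum_apply_mem (fun i v hv => V.smul_mem _ (hM i v hv)) a m hv)

/-- The polynomials are dense in `ℍ²(f)`. -/
lemma IsParallelModel.span_opWord_closure (hf : IsParallelModel f M) :
    (Submodule.span ℂ (Set.range fun α => opWord M α (basisVec 1))).topologicalClosure = ⊤ := by
  set V := (Submodule.span ℂ (Set.range fun α => opWord M α (basisVec 1))).topologicalClosure
    with hVdef
  have hV : IsClosed (V : Set (H2 n)) := Submodule.isClosed_topologicalClosure _
  have hM : ∀ i, ∀ v ∈ V, M i v ∈ V := fun i => by
    have : V ≤ V.comap (M i).toLinearMap := by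
      refine Submodule.topologicalClosure_minimal _ (Submodule.span_le.2 ?_)
        (hV.preimage (M i).continuous)
      rintro _ ⟨α, rfl⟩
      refine Submodule.le_topologicalClosure _ (Submodule.subset_span ⟨FreeMonoid.of i * α, ?_⟩)
      simp only [opWord_of_mul]
      rfl
    exact this
  -- Each `creation i` is a limit of polynomials in the `M_{Z_i}`, so it preserves the closed
  -- invariant subspace `V`, and creation operators reach every basis vector from the vacuum.
  have hb : ∀ α, basisVec α ∈ V := fun α => by
    induction α using FreeMonoid.recOn with
    | one =>
      exact Submodule.le_topologicalClosure _ (Submodule.subset_span ⟨1, by simp [opWord_one]⟩)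
    | of_mul i α ih =>
      rw [← creation_basisVec]
      exact (hf.hasNormEval i).apply_mem hV hM ih
  rw [eq_top_iff, ← span_basisVec_closure]
  refine Submodule.topologicalClosure_minimal _ (Submodule.span_le.2 ?_) hV
  rintro _ ⟨α, rfl⟩
  exact hb α

lemma IsParallelModel.creation_mem (hf : IsParallelModel f M) (j : Fin n) :
    creation j ∈ cstar M := (hf.hasNormEval j).mem_cstar

lemma ketBra_apply_left (T : H2 n →L[ℂ] H2 n) (x y : H2 n) :
    ketBra (T x) y = T * ketBra x y := by
  ext1 v
  simp [InnerProductSpace.rankOne_apply]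

lemma ketBra_mul_ketBra (x y z w : H2 n) :
    ketBra x y * ketBra z w = ⟪y, z⟫_ℂ • ketBra x w := by
  ext1 v
  simp [InnerProductSpace.rankOne_apply, smul_smul, mul_comm]

lemma star_ketBra (x y : H2 n) : star (ketBra x y) = ketBra y x :=
  InnerProductSpace.adjoint_rankOne x y

lemma inner_basisVec_one_self : ⟪basisVec (1 : FreeMonoid (Fin n)), basisVec 1⟫_ℂ = 1 := by
  rw [inner_basisVec, basisVec_apply, if_pos rfl]

/-- The vacuum projection is in the algebra; multiplying it on the left by words in the `M_{Z_i}`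
and taking limits gives every `z ↦ ⟨1, z⟩ x`, because the vacuum is cyclic. Products with adjoints
give the rest. -/
lemma IsParallelModel.ketBra_mem (hf : IsParallelModel f M) (x y : H2 n) :
    ketBra x y ∈ cstar M := by
  have h0 : ketBra (basisVec 1) (basisVec 1) ∈ cstar M := by
    rw [← one_sub_sum_creation]
    exact sub_mem (one_mem _) (sum_mem fun j _ =>
      mul_mem (hf.creation_mem j) (star_mem (hf.creation_mem j)))
  have h1 : ∀ x, ketBra x (basisVec 1) ∈ cstar M := fun x => by
    let V : Submodule ℂ (H2 n) := (Subalgebra.toSubmodule (cstar M).toSubalgebra).comap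
      ((InnerProductSpace.rankOne ℂ (E := H2 n) (F := H2 n)).flip (basisVec 1)).toLinearMap
    have hV : IsClosed (V : Set (H2 n)) := (isClosed_cstar M).preimage
      ((InnerProductSpace.rankOne ℂ (E := H2 n) (F := H2 n)).flip (basisVec 1)).continuous
    have : (⊤ : Submodule ℂ (H2 n)) ≤ V := by
      rw [← hf.span_opWord_closure]
      refine Submodule.topologicalClosure_minimal _ (Submodule.span_le.2 ?_) hV
      rintro _ ⟨α, rfl⟩
      change ketBra (opWord M α (basisVec 1)) (basisVec 1) ∈ cstar M
      rw [ketBra_apply_left]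
      exact mul_mem (opWord_mem M (gen_mem M) α) h0
    exact this (Submodule.mem_top (x := x))
  have h2 : ketBra x y = ketBra x (basisVec 1) * star (ketBra y (basisVec 1)) := by
    rw [star_ketBra, ketBra_mul_ketBra, inner_basisVec_one_self, one_smul]
  rw [h2]
  exact mul_mem (h1 x) (star_mem (h1 y))

lemma IsParallelModel.mem_of_isCompactOperator (hf : IsParallelModel f M)
    {X : H2 n →L[ℂ] H2 n} (hX : IsCompactOperator X) : X ∈ cstar M := by
  refine closure_minimal ?_ (isClosed_cstar M) (mem_closure_span_ketBra hX)
  have : Submodule.span ℂ {T : H2 n →L[ℂ] H2 n | ∃ x y, T = ketBra x y} ≤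
      Subalgebra.toSubmodule (cstar M).toSubalgebra := by
    refine Submodule.span_le.2 ?_
    rintro _ ⟨x, y, rfl⟩
    exact hf.ketBra_mem x y
  exact this

end Irreducible

/-! ### Unitaries from Gram matrices, Hilbert dimension, tensor products -/

section Hilbert

variable {E : Type*} [NormedAddCommGroup E] [InnerProductSpace ℂ E]
variable {F : Type*} [NormedAddCommGroup F] [InnerProductSpace ℂ F]

lemma denseRange_linearCombination {ι : Type*} {b : ι → E}
    (hb : (Submodule.span ℂ (Set.range b)).topologicalClosure = ⊤) :
    DenseRange (Finsupp.linearCombination ℂ b) := by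
  rw [DenseRange, ← LinearMap.coe_range, Finsupp.range_linearCombination]
  exact Submodule.dense_iff_topologicalClosure_eq_top.2 hb

/-- Total families with the same Gram matrix are unitarily equivalent. -/
lemma exists_unitary_of_gram_eq [CompleteSpace E] [CompleteSpace F] {ι : Type*} {b : ι → E}
    {b' : ι → F} (hb : (Submodule.span ℂ (Set.range b)).topologicalClosure = ⊤)
    (hb' : (Submodule.span ℂ (Set.range b')).topologicalClosure = ⊤)
    (h : ∀ i j, ⟪b i, b j⟫_ℂ = ⟪b' i, b' j⟫_ℂ) : ∃ U : E ≃ₗᵢ[ℂ] F, ∀ i, U (b i) = b' i := by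
  -- The families may be linearly dependent, so the map is defined on formal combinations, where
  -- equal Gram matrices give equal seminorms.
  have hn : ∀ c : ι →₀ ℂ, ‖Finsupp.linearCombination ℂ b' (LinearEquiv.refl ℂ _ c)‖ =
      ‖Finsupp.linearCombination ℂ b c‖ := fun c => by
    have : ⟪Finsupp.linearCombination ℂ b' c, Finsupp.linearCombination ℂ b' c⟫_ℂ =
        ⟪Finsupp.linearCombination ℂ b c, Finsupp.linearCombination ℂ b c⟫_ℂ := by
      simp only [Finsupp.linearCombination_apply, Finsupp.sum_inner, Finsupp.inner_sum,
        inner_smul_left, inner_smul_right, h]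
    rw [LinearEquiv.refl_apply, @norm_eq_sqrt_re_inner ℂ, @norm_eq_sqrt_re_inner ℂ, this]
  refine ⟨(LinearEquiv.refl ℂ (ι →₀ ℂ)).extendOfIsometry _ _
    (denseRange_linearCombination hb) (denseRange_linearCombination hb') hn, fun i => ?_⟩
  have := LinearEquiv.extendOfIsometry_eq (LinearEquiv.refl ℂ (ι →₀ ℂ)) _ _
    (denseRange_linearCombination hb) (denseRange_linearCombination hb') hn
    (Finsupp.single i 1)
  simpa using this

lemma span_closure_eq_top_of_orthogonal [CompleteSpace E] {s : Set E}
    (h : ∀ y, (∀ x ∈ s, ⟪x, y⟫_ℂ = 0) → y = 0) :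
    (Submodule.span ℂ s).topologicalClosure = ⊤ := by
  rw [Submodule.topologicalClosure_eq_top_iff, Submodule.eq_bot_iff]
  exact fun y hy => h y fun x hx => (Submodule.mem_orthogonal _ _).1 hy x (Submodule.subset_span hx)

lemma inner_eq_zero_of_mem_closure_span {s : Set E} {y : E} (h : ∀ x ∈ s, ⟪x, y⟫_ℂ = 0) {x : E}
    (hx : x ∈ (Submodule.span ℂ s).topologicalClosure) : ⟪x, y⟫_ℂ = 0 := by
  have h1 : Submodule.span ℂ s ≤ (ℂ ∙ y)ᗮ := Submodule.span_le.2 fun x hx =>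
    (Submodule.mem_orthogonal_singleton_iff_inner_left).2 (h x hx)
  exact (Submodule.mem_orthogonal_singleton_iff_inner_left).1
    (Submodule.topologicalClosure_minimal _ h1 (Submodule.isClosed_orthogonal _) hx)

lemma hilbertDim_le_of_inner_eq (j : E → F) (hj : ∀ x y, ⟪j x, j y⟫_ℂ = ⟪x, y⟫_ℂ) :
    hilbertDim E ≤ hilbertDim F := by
  classical
  refine iSup_le fun ⟨s, hs⟩ => ?_
  have h1 : Orthonormal ℂ fun x : s => j x := by
    rw [orthonormal_iff_ite] at hs ⊢
    intro x y
    rw [hj]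
    exact hs x y
  have h2 : Orthonormal ℂ ((↑) : Set.range (fun x : s => j x) → F) := h1.toSubtypeRange
  refine le_trans ?_ (le_iSup (fun s : {s : Set F // Orthonormal ℂ ((↑) : s → F)} =>
    (s : Set F).encard) ⟨_, h2⟩)
  have h3 := h1.linearIndependent.injective.encard_image (Set.univ : Set s)
  rw [Set.image_univ] at h3
  exact (h3.trans (by simp)).ge

lemma hilbertDim_eq_of_unitary (U : E ≃ₗᵢ[ℂ] F) : hilbertDim E = hilbertDim F :=
  le_antisymm (hilbertDim_le_of_inner_eq U U.inner_map_map)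
    (hilbertDim_le_of_inner_eq U.symm U.symm.inner_map_map)

/-- A finite basis spans algebraically, which bounds every linearly independent set; for an infinite
basis the value is already `⊤`. -/
lemma hilbertDim_eq_encard [CompleteSpace E] {w : Set E} (b : HilbertBasis w ℂ E)
    (hb : ⇑b = ((↑) : w → E)) : hilbertDim E = w.encard := by
  have hw : Orthonormal ℂ ((↑) : w → E) := hb ▸ b.orthonormal
  refine le_antisymm (iSup_le fun ⟨s, hs⟩ => ?_)
    (le_iSup (fun s : {s : Set E // Orthonormal ℂ ((↑) : s → E)} => (s : Set E).encard) ⟨w, hw⟩)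
  rcases w.finite_or_infinite with hfin | hinf
  · have := hfin.fintype
    have h1 : (Submodule.span ℂ w) = ⊤ := by
      have h2 := b.dense_span
      rw [hb, Subtype.range_coe] at h2
      have : FiniteDimensional ℂ (Submodule.span ℂ w) := FiniteDimensional.span_of_finite ℂ hfin
      rwa [(Submodule.closed_of_finiteDimensional _).submodule_topologicalClosure_eq] at h2
    have h3 := linearIndependent_le_span _ hs.linearIndependent w h1
    rw [← Cardinal.mk_fintype] at h3
    exact Cardinal.toENat.monotone' h3
  · simp [hinf.encard_eq]

lemma countable_of_orthonormal [TopologicalSpace.SeparableSpace E] {w : Set E}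
    (hw : Orthonormal ℂ ((↑) : w → E)) : w.Countable := by
  -- Distinct orthonormal vectors are at distance `√2`, so balls of radius `1/2` about them are
  -- disjoint.
  have h : w.PairwiseDisjoint fun x => Metric.ball x (1 / 2) := by
    intro x hx y hy hxy
    refine Metric.ball_disjoint_ball ?_
    have h1 : ⟪x, y⟫_ℂ = 0 := hw.2 (i := ⟨x, hx⟩) (j := ⟨y, hy⟩) fun h =>
      hxy (congrArg Subtype.val h)
    have h2 : ‖x - y‖ ^ 2 = 2 := by
      rw [@norm_sub_sq ℂ, h1, hw.1 ⟨x, hx⟩, hw.1 ⟨y, hy⟩]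
      norm_num
    rw [dist_eq_norm]
    nlinarith [norm_nonneg (x - y)]
  exact h.countable_of_isOpen (fun _ _ => Metric.isOpen_ball) fun x _ =>
    ⟨x, Metric.mem_ball_self (by norm_num)⟩

lemma separableSpace_submodule [TopologicalSpace.SeparableSpace E] (V : Submodule ℂ E) :
    TopologicalSpace.SeparableSpace V := by
  have := UniformSpace.secondCountable_of_separable E
  infer_instance

/-- Separable Hilbert spaces of the same dimension are unitarily equivalent. -/
lemma exists_unitary_of_hilbertDim_eq [CompleteSpace E] [CompleteSpace F]
    [TopologicalSpace.SeparableSpace E] [TopologicalSpace.SeparableSpace F]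
    (h : hilbertDim E = hilbertDim F) : Nonempty (E ≃ₗᵢ[ℂ] F) := by
  obtain ⟨w, b, hb⟩ := exists_hilbertBasis ℂ E
  obtain ⟨w', b', hb'⟩ := exists_hilbertBasis ℂ F
  rw [hilbertDim_eq_encard b hb, hilbertDim_eq_encard b' hb'] at h
  have hc := (countable_of_orthonormal (hb ▸ b.orthonormal)).le_aleph0
  have hc' := (countable_of_orthonormal (hb' ▸ b'.orthonormal)).le_aleph0
  -- Separability enters here: a dimension in `ℕ∞` determines a cardinal only among the countable
  -- ones.
  obtain ⟨e⟩ : Nonempty (w ≃ w') := by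
    rw [← Cardinal.lift_mk_eq']
    refine Cardinal.toENat_injOn (Cardinal.lift_le_aleph0.2 hc) (Cardinal.lift_le_aleph0.2 hc') ?_
    rwa [Cardinal.toENat_lift, Cardinal.toENat_lift, Set.toENat_cardinalMk, Set.toENat_cardinalMk]
  classical
  obtain ⟨U, -⟩ := exists_unitary_of_gram_eq (b := b) (b' := b' ∘ e) b.dense_span
    (by rw [e.surjective.range_comp]; exact b'.dense_span) fun i j => by
      simp [orthonormal_iff_ite.1 b.orthonormal, orthonormal_iff_ite.1 b'.orthonormal]
  exact ⟨U⟩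

lemma span_tmul_closure (E F : Type*) [NormedAddCommGroup E] [InnerProductSpace ℂ E]
    [NormedAddCommGroup F] [InnerProductSpace ℂ F] :
    (Submodule.span ℂ (Set.range fun p : E × F =>
      ((p.1 ⊗ₜ[ℂ] p.2 : E ⊗[ℂ] F) : UniformSpace.Completion (E ⊗[ℂ] F)))).topologicalClosure =
        ⊤ := by
  rw [← Submodule.dense_iff_topologicalClosure_eq_top]
  refine UniformSpace.Completion.denseRange_coe.mono ?_
  rintro _ ⟨t, rfl⟩
  induction t using TensorProduct.induction_on with
  | zero => exact Submodule.zero_mem _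
  | tmul x y => exact Submodule.subset_span ⟨(x, y), rfl⟩
  | add s t hs ht =>
    rw [UniformSpace.Completion.coe_add]
    exact Submodule.add_mem _ hs ht

lemma inner_tmul_completion (x x' : E) (y y' : F) :
    ⟪((x ⊗ₜ[ℂ] y : E ⊗[ℂ] F) : UniformSpace.Completion (E ⊗[ℂ] F)),
      ((x' ⊗ₜ[ℂ] y' : E ⊗[ℂ] F) : UniformSpace.Completion (E ⊗[ℂ] F))⟫_ℂ =
        ⟪x, x'⟫_ℂ * ⟪y, y'⟫_ℂ := by
  rw [UniformSpace.Completion.inner_coe, TensorProduct.inner_tmul]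

end Hilbert

/-! ### Restriction to invariant subspaces -/

section Restriction

variable {n : ℕ} {M : Fin n → (H2 n →L[ℂ] H2 n)}
variable {K : Type*} [NormedAddCommGroup K] [InnerProductSpace ℂ K] [CompleteSpace K]

lemma starRep_star_inner (π : StarRep M K) (a : cstar M) (x y : K) :
    ⟪π (star a) x, y⟫_ℂ = ⟪x, π a y⟫_ℂ := by
  rw [map_star, ContinuousLinearMap.star_eq_adjoint, ContinuousLinearMap.adjoint_inner_left]

lemma starRep_mul_apply (π : StarRep M K) (a b : cstar M) (x : K) :
    π (a * b) x = π a (π b x) := by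
  rw [map_mul, mul_apply_eq_comp]

/-- A representation restricts to its invariant subspaces. -/
lemma exists_isRestriction (π : StarRep M K) (V : Submodule ℂ K) [CompleteSpace V]
    (hV : ∀ a, ∀ x ∈ V, π a x ∈ V) : ∃ σ : StarRep M V, IsRestriction π V σ := by
  let r : cstar M → (V →L[ℂ] V) := fun a =>
    ((π a).comp V.subtypeL).codRestrict V fun x => hV a x x.2
  have hr : ∀ a (x : V), ((r a x : V) : K) = π a x := fun a x => rfl
  refine ⟨{ toFun := r, map_smul' := ?_, map_zero' := ?_, map_add' := ?_, map_mul' := ?_,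
            map_star' := ?_ }, hr⟩
  · intro c a
    ext x
    rw [hr, map_smul]
    rfl
  · ext x
    rw [hr, map_zero]
    rfl
  · intro a b
    ext x
    rw [hr, map_add]
    rfl
  · intro a b
    ext x
    rw [hr, starRep_mul_apply]
    rfl
  · intro a
    rw [ContinuousLinearMap.star_eq_adjoint, ContinuousLinearMap.eq_adjoint_iff]
    intro x y
    rw [Submodule.coe_inner, Submodule.coe_inner, hr, hr, starRep_star_inner]

lemma invariant_orthogonal (π : StarRep M K) (V : Submodule ℂ K)
    (hV : ∀ a, ∀ x ∈ V, π a x ∈ V) (a : cstar M) (x : K) (hx : x ∈ Vᗮ) :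
    π a x ∈ Vᗮ := by
  rw [Submodule.mem_orthogonal] at hx ⊢
  intro u hu
  rw [← starRep_star_inner]
  exact hx _ (hV _ _ hu)

lemma IsRestriction.map_one {π : StarRep M K} (h1 : π 1 = 1) {V : Submodule ℂ K}
    [CompleteSpace V] {σ : StarRep M V} (h : IsRestriction π V σ) : σ 1 = 1 := by
  ext x
  rw [h, h1]
  rfl

end Restriction

/-! ### Matrix units and the space `𝒦₀` -/

section Wold

variable {n : ℕ} {f : Fin n → NCSeries n} {M : Fin n → (H2 n →L[ℂ] H2 n)}
variable {K : Type*} [NormedAddCommGroup K] [InnerProductSpace ℂ K] [CompleteSpace K]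
variable {L : Type*} [NormedAddCommGroup L] [InnerProductSpace ℂ L] [CompleteSpace L]

/-- The rank one operator `z ↦ ⟨y, z⟩ x` as an element of `C*(M_Z)`. -/
def matUnit (hf : IsParallelModel f M) (x y : H2 n) : cstar M := ⟨ketBra x y, hf.ketBra_mem x y⟩

/-- The vector `f_∅ = 1` of `ℍ²(f)`. -/
abbrev vac (n : ℕ) : H2 n := basisVec 1

lemma mul_matUnit (hf : IsParallelModel f M) (a : cstar M) (x y : H2 n) :
    a * matUnit hf x y = matUnit hf ((a : H2 n →L[ℂ] H2 n) x) y :=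
  Subtype.ext (ketBra_apply_left _ _ _).symm

lemma star_matUnit (hf : IsParallelModel f M) (x y : H2 n) :
    star (matUnit hf x y) = matUnit hf y x :=
  Subtype.ext (star_ketBra x y)

lemma matUnit_mul_matUnit (hf : IsParallelModel f M) (x y z w : H2 n) :
    matUnit hf x y * matUnit hf z w = ⟪y, z⟫_ℂ • matUnit hf x w :=
  Subtype.ext (ketBra_mul_ketBra x y z w)

lemma matUnit_mul_vac (hf : IsParallelModel f M) (x : H2 n) (w : H2 n) :
    matUnit hf x (vac n) * matUnit hf (vac n) w = matUnit hf x w := by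
  rw [matUnit_mul_matUnit, inner_basisVec_one_self, one_smul]

lemma continuous_matUnit_left (hf : IsParallelModel f M) (y : H2 n) :
    Continuous fun x => matUnit hf x y :=
  Continuous.subtype_mk
    ((InnerProductSpace.rankOne ℂ (E := H2 n) (F := H2 n)).flip y).continuous _

/-- `π(z ↦ ⟨1, z⟩ x) k` depends linearly and continuously on `x`. -/
lemma matUnit_linear (hf : IsParallelModel f M) (π : StarRep M K) (k : K) :
    ∃ T : H2 n →L[ℂ] K, ∀ x, T x = π (matUnit hf x (vac n)) k := by
  refine ⟨⟨⟨⟨fun x => π (matUnit hf x (vac n)) k, fun x y => ?_⟩, fun c x => ?_⟩, ?_⟩,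
    fun x => rfl⟩
  · have : matUnit hf (x + y) (vac n) = matUnit hf x (vac n) + matUnit hf y (vac n) :=
      Subtype.ext (by
        change InnerProductSpace.rankOne ℂ (x + y) _ = _
        rw [map_add]; rfl)
    rw [this, map_add]
    rfl
  · have : matUnit hf (c • x) (vac n) = c • matUnit hf x (vac n) :=
      Subtype.ext (by
        change InnerProductSpace.rankOne ℂ (c • x) _ = _
        rw [map_smul]; rfl)
    change π (matUnit hf (c • x) (vac n)) k = _
    rw [this, map_smul]
    rfl
  · exact (ContinuousLinearMap.apply ℂ K k).continuous.comp
      ((continuous_starRep π).comp (continuous_matUnit_left hf _))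

lemma opEval_repTuple (hf : IsParallelModel f M) (π : StarRep M K) (h1 : π 1 = 1) (i : Fin n) :
    opEval (f i) (repTuple π) = π ⟨creation i, hf.creation_mem i⟩ :=
  ((hf.hasNormEval i).map (hf.creation_mem i) π h1).opEval_eq

lemma hasNormEval_repTuple (hf : IsParallelModel f M) (π : StarRep M K) (h1 : π 1 = 1)
    (i : Fin n) : HasNormEval (f i) (repTuple π) (opEval (f i) (repTuple π)) := by
  rw [opEval_repTuple hf π h1]
  exact (hf.hasNormEval i).map (hf.creation_mem i) π h1

/-- Hence the defect operator is a projection, and its range is the set of vectors that it fixes. -/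
lemma defect_eq (hf : IsParallelModel f M) (π : StarRep M K) (h1 : π 1 = 1) :
    defect f (repTuple π) = π (matUnit hf (vac n) (vac n)) := by
  have : matUnit hf (vac n) (vac n) = 1 - ∑ i, (⟨creation i, hf.creation_mem i⟩ : cstar M) *
      star (⟨creation i, hf.creation_mem i⟩ : cstar M) := Subtype.ext <| by
    rw [AddSubgroupClass.coe_sub, AddSubmonoidClass.coe_finsetSum]
    exact one_sub_sum_creation.symm
  rw [this, map_sub, h1, map_sum, defect]
  simp only [opEval_repTuple hf π h1, map_mul, map_star]

/-- The vectors that span the space `𝒦₀`. -/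
lemma woldSpace_eq (hf : IsParallelModel f M) (π : StarRep M K) (h1 : π 1 = 1) :
    woldSpace f π = (Submodule.span ℂ
      {y : K | ∃ x k, y = π (matUnit hf x (vac n)) k}).topologicalClosure := by
  have hα : ∀ α k, π (FreeMonoid.lift (gen M) α) (defect f (repTuple π) k) =
      π (matUnit hf (opWord M α (vac n)) (vac n)) k := fun α k => by
    rw [defect_eq hf π h1, ← starRep_mul_apply, mul_matUnit, opWord_coe]
    rfl
  refine le_antisymm (Submodule.topologicalClosure_mono (Submodule.span_mono ?_))
    (Submodule.topologicalClosure_minimal _ (Submodule.span_le.2 ?_)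
      (Submodule.isClosed_topologicalClosure _))
  · rintro _ ⟨α, k, rfl⟩
    exact ⟨opWord M α (vac n), k, hα α k⟩
  · rintro _ ⟨x, k, rfl⟩
    obtain ⟨T, hT⟩ := matUnit_linear hf π k
    -- The words in `M_Z` applied to the vacuum are total, and the dependence on `x` is linear and
    -- continuous, so arbitrary `x` may replace them.
    have : (⊤ : Submodule ℂ (H2 n)) ≤ (woldSpace f π).comap T.toLinearMap := by
      rw [← hf.span_opWord_closure]
      refine Submodule.topologicalClosure_minimal _ (Submodule.span_le.2 ?_)
        ((Submodule.isClosed_topologicalClosure _).preimage T.continuous)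
      rintro _ ⟨α, rfl⟩
      refine Submodule.le_topologicalClosure _ (Submodule.subset_span ⟨α, k, ?_⟩)
      rw [hα, ← hT]
      rfl
    rw [← hT]
    exact this (Submodule.mem_top (x := x))


lemma matUnit_apply_mem_woldSpace (hf : IsParallelModel f M) (π : StarRep M K) (h1 : π 1 = 1)
    (x y : H2 n) (k : K) :
    π (matUnit hf x y) k ∈ woldSpace f π := by
  rw [← matUnit_mul_vac hf x y, starRep_mul_apply, woldSpace_eq hf π h1]
  exact Submodule.le_topologicalClosure _ (Submodule.subset_span ⟨x, _, rfl⟩)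

lemma woldSpace_invariant (hf : IsParallelModel f M) (π : StarRep M K) (h1 : π 1 = 1)
    (a : cstar M) (k : K) (hk : k ∈ woldSpace f π) :
    π a k ∈ woldSpace f π := by
  have : woldSpace f π ≤ (woldSpace f π).comap (π a).toLinearMap := by
    conv_lhs => rw [woldSpace_eq hf π h1]
    refine Submodule.topologicalClosure_minimal _ (Submodule.span_le.2 ?_)
      ((Submodule.isClosed_topologicalClosure _).preimage (π a).continuous)
    rintro _ ⟨x, k, rfl⟩
    change π a (π (matUnit hf x (vac n)) k) ∈ woldSpace f π
    rw [← starRep_mul_apply, mul_matUnit]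
    exact matUnit_apply_mem_woldSpace hf π h1 _ _ _
  exact this hk

/-- The adjoint of `π(e_{x,1})` is `π(e_{1,x})`. Since every rank one operator factors through the
vacuum, all of them act as zero on `𝒦₁`. -/
lemma mem_woldSpace_orthogonal_iff (hf : IsParallelModel f M) (π : StarRep M K) (h1 : π 1 = 1)
    (k : K) :
    k ∈ (woldSpace f π)ᗮ ↔ ∀ x, π (matUnit hf (vac n) x) k = 0 := by
  constructor
  · intro hk x
    refine ext_inner_left ℂ fun y => ?_
    rw [inner_zero_right, ← starRep_star_inner, star_matUnit]
    exact (Submodule.mem_orthogonal _ _).1 hk _ (matUnit_apply_mem_woldSpace hf π h1 _ _ _)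
  · intro h
    rw [Submodule.mem_orthogonal, woldSpace_eq hf π h1]
    intro u hu
    refine inner_eq_zero_of_mem_closure_span ?_ hu
    rintro _ ⟨x, y, rfl⟩
    rw [← star_matUnit, starRep_star_inner, h, inner_zero_right]

end Wold

/-! ### Structure of the two summands and unitary equivalence -/

section Structure

variable {n : ℕ} {f : Fin n → NCSeries n} {M : Fin n → (H2 n →L[ℂ] H2 n)}
variable {K : Type*} [NormedAddCommGroup K] [InnerProductSpace ℂ K] [CompleteSpace K]
variable {L : Type*} [NormedAddCommGroup L] [InnerProductSpace ℂ L] [CompleteSpace L]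

/-- The range of the defect operator of `f(π(M_Z))`. -/
abbrev defectSpace (f : Fin n → NCSeries n) (π : StarRep M K) : Submodule ℂ K :=
  LinearMap.range (defect f (repTuple π)).toLinearMap

lemma mem_defectSpace_iff (hf : IsParallelModel f M) (π : StarRep M K) (h1 : π 1 = 1) (k : K) :
    k ∈ defectSpace f π ↔ π (matUnit hf (vac n) (vac n)) k = k := by
  rw [defectSpace, defect_eq hf π h1]
  constructor
  · rintro ⟨x, rfl⟩
    change π _ (π _ x) = π _ x
    rw [← starRep_mul_apply, matUnit_mul_vac]
  · exact fun h => ⟨k, h⟩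

lemma matUnit_apply_mem_defectSpace (hf : IsParallelModel f M) (π : StarRep M K) (h1 : π 1 = 1)
    (x : H2 n) (k : K) : π (matUnit hf (vac n) x) k ∈ defectSpace f π := by
  rw [mem_defectSpace_iff hf π h1, ← starRep_mul_apply, matUnit_mul_vac]

lemma completeSpace_defectSpace (hf : IsParallelModel f M) (π : StarRep M K) (h1 : π 1 = 1) :
    CompleteSpace (defectSpace f π) := by
  have : IsClosed (defectSpace f π : Set K) := by
    have h : (defectSpace f π : Set K) = {k | π (matUnit hf (vac n) (vac n)) k = k} :=
      Set.ext fun k => mem_defectSpace_iff hf π h1 k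
    rw [h]
    exact isClosed_eq (ContinuousLinearMap.continuous _) continuous_id
  exact this.completeSpace_coe

lemma inner_matUnit_apply (hf : IsParallelModel f M) (π : StarRep M K) (x y : H2 n) (k l : K) :
    ⟪π (matUnit hf x (vac n)) k, π (matUnit hf y (vac n)) l⟫_ℂ =
      ⟪x, y⟫_ℂ * ⟪k, π (matUnit hf (vac n) (vac n)) l⟫_ℂ := by
  rw [← star_matUnit, starRep_star_inner, ← starRep_mul_apply, matUnit_mul_matUnit, map_smul,
    _root_.smul_apply, inner_smul_right]

/-- The right-hand side is the inner product of elementary tensors, so `x ⊗ g ↦ π(e_{x,1}) g` is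
isometric. -/
lemma inner_matUnit_defectSpace (hf : IsParallelModel f M) (π : StarRep M K) (h1 : π 1 = 1)
    (x y : H2 n) (k l : defectSpace f π) :
    ⟪π (matUnit hf x (vac n)) k, π (matUnit hf y (vac n)) l⟫_ℂ = ⟪x, y⟫_ℂ * ⟪k, l⟫_ℂ := by
  rw [inner_matUnit_apply, (mem_defectSpace_iff hf π h1 _).1 l.2]
  rfl

/-- A vector orthogonal to all `π(x ⊗ 1*) g`, for `g` in the range of the defect operator, is
orthogonal to `𝒦₀`. -/
lemma mem_woldSpace_orthogonal_of_inner (hf : IsParallelModel f M) (π : StarRep M K)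
    (h1 : π 1 = 1) (k : K)
    (hk : ∀ x, ∀ g ∈ defectSpace f π, ⟪π (matUnit hf x (vac n)) g, k⟫_ℂ = 0) :
    k ∈ (woldSpace f π)ᗮ := by
  rw [mem_woldSpace_orthogonal_iff hf π h1]
  intro x
  refine ext_inner_left ℂ fun y => ?_
  rw [inner_zero_right, ← starRep_star_inner, star_matUnit, ← matUnit_mul_vac, starRep_mul_apply]
  exact hk x _ (matUnit_apply_mem_defectSpace hf π h1 _ _)

lemma span_woldSpace_closure (hf : IsParallelModel f M) (π : StarRep M K) (h1 : π 1 = 1) :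
    (Submodule.span ℂ (Set.range fun p : H2 n × defectSpace f π =>
      (⟨π (matUnit hf p.1 (vac n)) p.2, matUnit_apply_mem_woldSpace hf π h1 _ _ _⟩ :
        woldSpace f π))).topologicalClosure = ⊤ := by
  refine span_closure_eq_top_of_orthogonal fun y hy => ?_
  have h := mem_woldSpace_orthogonal_of_inner hf π h1 y fun x g hg =>
    hy _ ⟨(x, ⟨g, hg⟩), rfl⟩
  exact Subtype.ext (inner_self_eq_zero.1 ((Submodule.mem_orthogonal _ _).1 h y y.2))

lemma isMultipleOfId_woldSpace (hf : IsParallelModel f M) (π : StarRep M K) (h1 : π 1 = 1)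
    (π₀ : StarRep M (woldSpace f π)) (h0 : IsRestriction π (woldSpace f π) π₀) :
    IsMultipleOfId π₀ (defectSpace f π) := by
  have hinner : ∀ p q : H2 n × defectSpace f π,
      ⟪((p.1 ⊗ₜ[ℂ] p.2 : H2 n ⊗[ℂ] defectSpace f π) :
          UniformSpace.Completion (H2 n ⊗[ℂ] defectSpace f π)),
        ((q.1 ⊗ₜ[ℂ] q.2 : H2 n ⊗[ℂ] defectSpace f π) :
          UniformSpace.Completion (H2 n ⊗[ℂ] defectSpace f π))⟫_ℂ =
      ⟪(⟨π (matUnit hf p.1 (vac n)) p.2, matUnit_apply_mem_woldSpace hf π h1 _ _ _⟩ :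
        woldSpace f π), ⟨π (matUnit hf q.1 (vac n)) q.2,
          matUnit_apply_mem_woldSpace hf π h1 _ _ _⟩⟫_ℂ := fun p q => by
    exact (inner_tmul_completion _ _ _ _).trans
      (inner_matUnit_defectSpace hf π h1 _ _ _ _).symm
  obtain ⟨U, hU⟩ := exists_unitary_of_gram_eq (span_tmul_closure (H2 n) (defectSpace f π))
    (span_woldSpace_closure hf π h1) hinner
  refine ⟨U, fun a h g => ?_⟩
  rw [hU (h, g), hU ((a : H2 n →L[ℂ] H2 n) h, g)]
  refine Subtype.ext ?_
  rw [h0]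
  change π a (π _ _) = _
  rw [← starRep_mul_apply, mul_matUnit]

/-- `𝒦₀` is spanned by vectors of the form `π₀(e) v` with `e` of rank one. An intertwiner sends
these to `π₁(e) (T v)`, and `π₁` annihilates `e`. -/
lemma disjointRep_woldSpace (hf : IsParallelModel f M) (π : StarRep M K) (h1 : π 1 = 1)
    {π₀ : StarRep M (woldSpace f π)} (h0 : IsRestriction π (woldSpace f π) π₀)
    {π₁ : StarRep M ↥(woldSpace f π)ᗮ} (h0' : IsRestriction π (woldSpace f π)ᗮ π₁) :
    DisjointRep π₀ π₁ := by
  intro T hT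
  refine clm_ext_of_span_dense (span_woldSpace_closure hf π h1) ?_
  rintro _ ⟨⟨x, g⟩, rfl⟩
  have h2 : (⟨π (matUnit hf x (vac n)) g, matUnit_apply_mem_woldSpace hf π h1 _ _ _⟩ :
      woldSpace f π) = π₀ (matUnit hf x (vac n))
        (π₀ (matUnit hf (vac n) (vac n)) ⟨g, by
          rw [← (mem_defectSpace_iff hf π h1 _).1 g.2]
          exact matUnit_apply_mem_woldSpace hf π h1 _ _ _⟩) := by
    refine Subtype.ext ?_
    rw [h0, h0, (mem_defectSpace_iff hf π h1 _).1 g.2]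
  refine (congrArg T h2).trans ?_
  rw [hT, hT]
  refine Subtype.ext ?_
  rw [h0', h0', (mem_woldSpace_orthogonal_iff hf π h1 _).1 (T _).2, map_zero]
  rfl

lemma map_matUnit_eq_zero (hf : IsParallelModel f M) (π : StarRep M K) (h1 : π 1 = 1)
    {π₁ : StarRep M ↥(woldSpace f π)ᗮ} (h0 : IsRestriction π (woldSpace f π)ᗮ π₁) (x y : H2 n) :
    π₁ (matUnit hf x y) = 0 := by
  ext k
  rw [h0, ← matUnit_mul_vac, starRep_mul_apply, (mem_woldSpace_orthogonal_iff hf π h1 _).1 k.2,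
    map_zero]
  rfl

lemma map_compact_eq_zero (hf : IsParallelModel f M) (π : StarRep M K) (h1 : π 1 = 1)
    {π₁ : StarRep M ↥(woldSpace f π)ᗮ} (h0 : IsRestriction π (woldSpace f π)ᗮ π₁)
    {X : H2 n →L[ℂ] H2 n} (hX : IsCompactOperator X) (hmem : X ∈ cstar M) :
    π₁ ⟨X, hmem⟩ = 0 := by
  have h2 : ∀ T ∈ Submodule.span ℂ {T : H2 n →L[ℂ] H2 n | ∃ x y, T = ketBra x y},
      ∃ hT : T ∈ cstar M, π₁ ⟨T, hT⟩ = 0 := fun T hT => by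
    induction hT using Submodule.span_induction with
    | mem T h =>
      obtain ⟨x, y, rfl⟩ := h
      exact ⟨hf.ketBra_mem x y, map_matUnit_eq_zero hf π h1 h0 x y⟩
    | zero => exact ⟨zero_mem _, map_zero π₁⟩
    | add S T _ _ hS hT =>
      obtain ⟨hS, hS'⟩ := hS
      obtain ⟨hT, hT'⟩ := hT
      refine ⟨add_mem hS hT, ?_⟩
      have := map_add π₁ ⟨S, hS⟩ ⟨T, hT⟩
      rwa [hS', hT', add_zero] at this
    | smul c T _ hT =>
      obtain ⟨hT, hT'⟩ := hT
      refine ⟨(cstar M).smul_mem hT c, ?_⟩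
      have := map_smul π₁ c ⟨T, hT⟩
      rwa [hT', smul_zero] at this
  obtain ⟨u, hu, hlim⟩ := mem_closure_iff_seq_limit.1 (mem_closure_span_ketBra hX)
  have h3 : Tendsto (fun m => (⟨u m, (h2 _ (hu m)).1⟩ : cstar M)) atTop (𝓝 ⟨X, hmem⟩) :=
    tendsto_subtype_rng.2 hlim
  have h4 := ((continuous_starRep π₁).tendsto _).comp h3
  refine tendsto_nhds_unique h4 (tendsto_const_nhds.congr fun m => ?_)
  exact (h2 _ (hu m)).2.symm

/-- The defect operator of `π₁` is the image of the vacuum projection, which `π₁` annihilates. -/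
lemma sum_opEval_mul_star_eq_one (hf : IsParallelModel f M) (π : StarRep M K) (h1 : π 1 = 1)
    {π₁ : StarRep M ↥(woldSpace f π)ᗮ} (h0 : IsRestriction π (woldSpace f π)ᗮ π₁) :
    ∑ i, opEval (f i) (repTuple π₁) * star (opEval (f i) (repTuple π₁)) = 1 := by
  have := defect_eq hf π₁ (h0.map_one h1)
  rw [map_matUnit_eq_zero hf π h1 h0, defect, sub_eq_zero] at this
  exact this.symm

/-- The multiplicity space of `π₀` is the range of the defect operator. -/
lemma IsMultipleOfId.exists_unitary_defectSpace (hf : IsParallelModel f M) (π : StarRep M K)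
    (h1 : π 1 = 1) {π₀ : StarRep M (woldSpace f π)} (h0 : IsRestriction π (woldSpace f π) π₀)
    {G : Type*} [NormedAddCommGroup G] [InnerProductSpace ℂ G] [CompleteSpace G]
    (h : IsMultipleOfId π₀ G) : Nonempty (G ≃ₗᵢ[ℂ] defectSpace f π) := by
  obtain ⟨U, hU⟩ := h
  have := completeSpace_defectSpace hf π h1
  -- Through `U` the defect projection acts on the first leg only, as the vacuum projection; so its
  -- range should be the image of `1 ⊗ G`.
  have hQ : ∀ x g, π (matUnit hf (vac n) (vac n)) (U ((x ⊗ₜ[ℂ] g : H2 n ⊗[ℂ] G) :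
      UniformSpace.Completion (H2 n ⊗[ℂ] G))) = ⟪vac n, x⟫_ℂ • ((U ((vac n ⊗ₜ[ℂ] g :
        H2 n ⊗[ℂ] G) : UniformSpace.Completion (H2 n ⊗[ℂ] G)) : woldSpace f π) : K) :=
    fun x g => by
    rw [← h0, hU]
    change (U ((ketBra (vac n) (vac n) x ⊗ₜ[ℂ] g : H2 n ⊗[ℂ] G) :
      UniformSpace.Completion (H2 n ⊗[ℂ] G)) : K) = _
    rw [InnerProductSpace.rankOne_apply, ← TensorProduct.smul_tmul',
      UniformSpace.Completion.coe_smul, map_smul]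
    rfl
  let j : G → defectSpace f π := fun g => ⟨U ((vac n ⊗ₜ[ℂ] g : H2 n ⊗[ℂ] G) :
      UniformSpace.Completion (H2 n ⊗[ℂ] G)), by
    rw [mem_defectSpace_iff hf π h1, hQ, inner_basisVec_one_self, one_smul]⟩
  have hj : ∀ g g', ⟪g, g'⟫_ℂ = ⟪j g, j g'⟫_ℂ := fun g g' => by
    change _ = ⟪U _, U _⟫_ℂ
    rw [U.inner_map_map, inner_tmul_completion, inner_basisVec_one_self, one_mul]
  have hid : (Submodule.span ℂ (Set.range (id : G → G))).topologicalClosure = ⊤ := by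
    rw [Set.range_id, Submodule.span_univ]
    exact top_le_iff.1 (Submodule.le_topologicalClosure _)
  have hd : (Submodule.span ℂ (Set.range j)).topologicalClosure = ⊤ := by
    refine span_closure_eq_top_of_orthogonal fun y hy => ?_
    have hyQ := (mem_defectSpace_iff hf π h1 _).1 y.2
    have hyW : (y : K) ∈ woldSpace f π := by
      rw [← hyQ]
      exact matUnit_apply_mem_woldSpace hf π h1 _ _ _
    have h2 : U.symm ⟨y, hyW⟩ = 0 := by
      -- Since `y` is fixed by the defect projection, its inner product with `U (x ⊗ g)` is a
      -- multiple of that with `U (1 ⊗ g)`, which vanishes by assumption.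
      have h3 : ∀ z ∈ (⊤ : Submodule ℂ (UniformSpace.Completion (H2 n ⊗[ℂ] G))),
          ⟪z, U.symm ⟨y, hyW⟩⟫_ℂ = 0 := fun z hz => by
        rw [← span_tmul_closure (H2 n) G] at hz
        refine inner_eq_zero_of_mem_closure_span ?_ hz
        rintro _ ⟨⟨x, g⟩, rfl⟩
        rw [← U.inner_map_map, U.apply_symm_apply]
        change ⟪((U _ : woldSpace f π) : K), (y : K)⟫_ℂ = 0
        rw [← hyQ, ← starRep_star_inner, star_matUnit, hQ, inner_smul_left]
        have := hy _ ⟨g, rfl⟩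
        change ⟪((U _ : woldSpace f π) : K), (y : K)⟫_ℂ = 0 at this
        rw [this, mul_zero]
      exact inner_self_eq_zero.1 (h3 _ Submodule.mem_top)
    have h4 : (⟨y, hyW⟩ : woldSpace f π) = 0 := by
      rw [← U.apply_symm_apply ⟨y, hyW⟩, h2, map_zero]
    have h5 : (y : K) = 0 := congrArg Subtype.val h4
    exact Subtype.ext h5
  obtain ⟨V, -⟩ := exists_unitary_of_gram_eq hid hd hj
  exact ⟨V⟩

lemma apply_mem_defectSpace_of_intertwines (hf : IsParallelModel f M) {π : StarRep M K}
    (h1 : π 1 = 1) {π' : StarRep M L} (h1' : π' 1 = 1) (U : K ≃ₗᵢ[ℂ] L)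
    (hU : ∀ a x, U (π a x) = π' a (U x)) {k : K} (hk : k ∈ defectSpace f π) :
    U k ∈ defectSpace f π' := by
  rw [mem_defectSpace_iff hf π' h1', ← hU, (mem_defectSpace_iff hf π h1 _).1 hk]

lemma apply_mem_woldSpace_orthogonal_of_intertwines (hf : IsParallelModel f M) {π : StarRep M K}
    (h1 : π 1 = 1) {π' : StarRep M L} (h1' : π' 1 = 1) (U : K ≃ₗᵢ[ℂ] L)
    (hU : ∀ a x, U (π a x) = π' a (U x)) {k : K} (hk : k ∈ (woldSpace f π)ᗮ) :
    U k ∈ (woldSpace f π')ᗮ := by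
  rw [mem_woldSpace_orthogonal_iff hf π' h1']
  intro x
  rw [← hU, (mem_woldSpace_orthogonal_iff hf π h1 _).1 hk, map_zero]

lemma intertwines_symm {π : StarRep M K} {π' : StarRep M L} (U : K ≃ₗᵢ[ℂ] L)
    (hU : ∀ a x, U (π a x) = π' a (U x)) (a : cstar M) (y : L) :
    U.symm (π' a y) = π a (U.symm y) := by
  rw [U.symm_apply_eq, hU, U.apply_symm_apply]

lemma UnitarilyEquiv.hilbertDim_defectSpace (hf : IsParallelModel f M) {π : StarRep M K}
    (h1 : π 1 = 1) {π' : StarRep M L} (h1' : π' 1 = 1) (h : UnitarilyEquiv π π') :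
    hilbertDim (defectSpace f π) = hilbertDim (defectSpace f π') := by
  obtain ⟨U, hU⟩ := h
  refine le_antisymm (hilbertDim_le_of_inner_eq
    (fun k => ⟨U k, apply_mem_defectSpace_of_intertwines hf h1 h1' U hU k.2⟩) fun x y => ?_)
    (hilbertDim_le_of_inner_eq (fun k => ⟨U.symm k, apply_mem_defectSpace_of_intertwines hf h1' h1
      U.symm (intertwines_symm U hU) k.2⟩) fun x y => ?_)
  · exact U.inner_map_map _ _
  · exact U.symm.inner_map_map _ _

lemma UnitarilyEquiv.restrict_orthogonal (hf : IsParallelModel f M) {π : StarRep M K}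
    (h1 : π 1 = 1) {π' : StarRep M L} (h1' : π' 1 = 1)
    {π₁ : StarRep M ↥(woldSpace f π)ᗮ} (hr : IsRestriction π (woldSpace f π)ᗮ π₁)
    {π₁' : StarRep M ↥(woldSpace f π')ᗮ} (hr' : IsRestriction π' (woldSpace f π')ᗮ π₁')
    (h : UnitarilyEquiv π π') : UnitarilyEquiv π₁ π₁' := by
  obtain ⟨U, hU⟩ := h
  let e : ↥(woldSpace f π)ᗮ ≃ₗ[ℂ] ↥(woldSpace f π')ᗮ :=
    { toFun := fun k =>
        ⟨U k, apply_mem_woldSpace_orthogonal_of_intertwines hf h1 h1' U hU k.2⟩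
      invFun := fun k => ⟨U.symm k, apply_mem_woldSpace_orthogonal_of_intertwines hf h1' h1
        U.symm (intertwines_symm U hU) k.2⟩
      map_add' := fun x y => Subtype.ext (map_add U (x : K) y)
      map_smul' := fun c x => Subtype.ext (map_smul U c (x : K))
      left_inv := fun x => Subtype.ext (U.symm_apply_apply _)
      right_inv := fun x => Subtype.ext (U.apply_symm_apply _) }
  refine ⟨⟨e, fun x => U.norm_map _⟩, fun a x => Subtype.ext ?_⟩
  rw [hr']
  change U ((π₁ a x : ↥(woldSpace f π)ᗮ) : K) = π' a (U x)
  rw [hr, hU]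

/-- The vectors `π(e_{x,1}) g` together with `𝒦₁` form a total family in `K`; their counterparts
under `V` and `W` form one in `L` with the same Gram matrix. The resulting unitary intertwines
because `a e_{x,1} = e_{a x,1}` on the first kind and `W` intertwines on the second. -/
lemma unitarilyEquiv_of_defectSpace (hf : IsParallelModel f M) {π : StarRep M K}
    (h1 : π 1 = 1) {π' : StarRep M L} (h1' : π' 1 = 1)
    {π₁ : StarRep M ↥(woldSpace f π)ᗮ} (hr : IsRestriction π (woldSpace f π)ᗮ π₁)
    {π₁' : StarRep M ↥(woldSpace f π')ᗮ} (hr' : IsRestriction π' (woldSpace f π')ᗮ π₁')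
    (V : defectSpace f π ≃ₗᵢ[ℂ] defectSpace f π') (h : UnitarilyEquiv π₁ π₁') :
    UnitarilyEquiv π π' := by
  obtain ⟨W, hW⟩ := h
  let b : (H2 n × defectSpace f π) ⊕ ↥(woldSpace f π)ᗮ → K :=
    Sum.elim (fun p => π (matUnit hf p.1 (vac n)) p.2) (fun x => x)
  let b' : (H2 n × defectSpace f π) ⊕ ↥(woldSpace f π)ᗮ → L :=
    Sum.elim (fun p => π' (matUnit hf p.1 (vac n)) (V p.2)) (fun x => W x)
  have hb : (Submodule.span ℂ (Set.range b)).topologicalClosure = ⊤ := by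
    refine span_closure_eq_top_of_orthogonal fun y hy => ?_
    have hy1 := mem_woldSpace_orthogonal_of_inner hf π h1 y fun x g hg =>
      hy _ ⟨Sum.inl (x, ⟨g, hg⟩), rfl⟩
    exact inner_self_eq_zero.1 (hy y ⟨Sum.inr ⟨y, hy1⟩, rfl⟩)
  have hb' : (Submodule.span ℂ (Set.range b')).topologicalClosure = ⊤ := by
    refine span_closure_eq_top_of_orthogonal fun y hy => ?_
    have hy1 := mem_woldSpace_orthogonal_of_inner hf π' h1' y fun x g hg =>
      hy _ ⟨Sum.inl (x, V.symm ⟨g, hg⟩), by simp [b']⟩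
    exact inner_self_eq_zero.1 (hy y ⟨Sum.inr (W.symm ⟨y, hy1⟩), by simp [b']⟩)
  have hgram : ∀ i j, ⟪b i, b j⟫_ℂ = ⟪b' i, b' j⟫_ℂ := by
    rintro (⟨x, g⟩ | x) (⟨y, g'⟩ | y)
    · change ⟪π _ _, π _ _⟫_ℂ = ⟪π' _ _, π' _ _⟫_ℂ
      rw [inner_matUnit_defectSpace hf π h1, inner_matUnit_defectSpace hf π' h1',
        V.inner_map_map]
    · have e1 := (Submodule.mem_orthogonal _ _).1 y.2 _
        (matUnit_apply_mem_woldSpace hf π h1 x (vac n) g)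
      have e2 := (Submodule.mem_orthogonal _ _).1 (W y).2 _
        (matUnit_apply_mem_woldSpace hf π' h1' x (vac n) (V g))
      exact e1.trans e2.symm
    · have e1 := (Submodule.mem_orthogonal' _ _).1 x.2 _
        (matUnit_apply_mem_woldSpace hf π h1 y (vac n) g')
      have e2 := (Submodule.mem_orthogonal' _ _).1 (W x).2 _
        (matUnit_apply_mem_woldSpace hf π' h1' y (vac n) (V g'))
      exact e1.trans e2.symm
    · exact (W.inner_map_map x y).symm
  obtain ⟨U, hU⟩ := exists_unitary_of_gram_eq hb hb' hgram
  refine ⟨U, fun a x => ?_⟩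
  have key : (U.toContinuousLinearEquiv : K →L[ℂ] L).comp (π a) =
      (π' a).comp (U.toContinuousLinearEquiv : K →L[ℂ] L) := by
    refine clm_ext_of_span_dense hb ?_
    rintro _ ⟨i, rfl⟩
    change U (π a (b i)) = π' a (U (b i))
    rw [hU]
    rcases i with ⟨x, g⟩ | x
    · have e1 : π a (b (Sum.inl (x, g))) = b (Sum.inl ((a : H2 n →L[ℂ] H2 n) x, g)) := by
        change π a (π _ _) = π _ _
        rw [← starRep_mul_apply, mul_matUnit]
      rw [e1, hU]
      change π' _ _ = π' a (π' _ _)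
      rw [← starRep_mul_apply, mul_matUnit]
    · have e1 : π a (b (Sum.inr x)) = b (Sum.inr (π₁ a x)) := (hr a x).symm
      rw [e1, hU]
      change ((W (π₁ a x) : ↥(woldSpace f π')ᗮ) : L) = π' a (W x)
      rw [hW, hr']
  exact DFunLike.congr_fun key x

end Structure

end NCDomain

end

theorem theorem3p2 {n : ℕ} (hn : 1 ≤ n) (f : Fin n → NCSeries n)
    (M : Fin n → (H2 n →L[ℂ] H2 n)) (hf : IsParallelModel f M)
    (K : Type u) [NormedAddCommGroup K] [InnerProductSpace ℂ K] [CompleteSpace K]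
    [TopologicalSpace.SeparableSpace K] (π : StarRep M K) (hπ : Nondegenerate π) :
    -- the evaluations `f_i(π(M_Z))` exist
    (∀ i, HasNormEval (f i) (repTuple π) (opEval (f i) (repTuple π))) ∧
    ∃ (π₀ : StarRep M (woldSpace f π)) (π₁ : StarRep M ↥(woldSpace f π)ᗮ)
      (G : Type u) (_ : NormedAddCommGroup G) (_ : InnerProductSpace ℂ G)
      (_ : CompleteSpace G) (_ : TopologicalSpace.SeparableSpace G),
      -- `π = π₀ ⊕ π₁` with disjoint summands
      IsRestriction π (woldSpace f π) π₀ ∧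
      IsRestriction π (woldSpace f π)ᗮ π₁ ∧
      DisjointRep π₀ π₁ ∧
      -- `π₀` is a multiple of the identity representation
      IsMultipleOfId π₀ G ∧
      hilbertDim G = hilbertDim (LinearMap.range (defect f (repTuple π)).toLinearMap) ∧
      -- `π₁` annihilates the compact operators, all of which lie in the C*-algebra
      (∀ X : H2 n →L[ℂ] H2 n, IsCompactOperator X → ∃ hX : X ∈ cstar M, π₁ ⟨X, hX⟩ = 0) ∧
      (∀ i, HasNormEval (f i) (repTuple π₁) (opEval (f i) (repTuple π₁))) ∧
      ∑ i, opEval (f i) (repTuple π₁) * star (opEval (f i) (repTuple π₁)) = 1 ∧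
      -- classification up to unitary equivalence
      ∀ (K' : Type v) [NormedAddCommGroup K'] [InnerProductSpace ℂ K'] [CompleteSpace K']
        [TopologicalSpace.SeparableSpace K'] (π' : StarRep M K'), Nondegenerate π' →
        ∀ (π₀' : StarRep M (woldSpace f π')) (π₁' : StarRep M ↥(woldSpace f π')ᗮ)
          (G' : Type w) [NormedAddCommGroup G'] [InnerProductSpace ℂ G'] [CompleteSpace G'],
          IsRestriction π' (woldSpace f π') π₀' →
          IsRestriction π' (woldSpace f π')ᗮ π₁' →
          IsMultipleOfId π₀' G' →
          (UnitarilyEquiv π π' ↔ hilbertDim G = hilbertDim G' ∧ UnitarilyEquiv π₁ π₁') := by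
  have h1 := hπ.map_one
  obtain ⟨π₀, h0⟩ := exists_isRestriction π (woldSpace f π) (woldSpace_invariant hf π h1)
  obtain ⟨π₁, h0'⟩ := exists_isRestriction π (woldSpace f π)ᗮ
    (invariant_orthogonal π _ (woldSpace_invariant hf π h1))
  refine ⟨hasNormEval_repTuple hf π h1, π₀, π₁, defectSpace f π, inferInstance, inferInstance,
    completeSpace_defectSpace hf π h1, separableSpace_submodule _, h0, h0',
    disjointRep_woldSpace hf π h1 h0 h0', isMultipleOfId_woldSpace hf π h1 π₀ h0, rfl,
    fun X hX => ⟨hf.mem_of_isCompactOperator hX, map_compact_eq_zero hf π h1 h0' hX _⟩,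
    hasNormEval_repTuple hf π₁ (h0'.map_one h1), sum_opEval_mul_star_eq_one hf π h1 h0', ?_⟩
  intro K' _ _ _ _ π' hπ' π₀' π₁' G' _ _ _ hr hr' hG'
  have h1' := hπ'.map_one
  -- Any multiplicity space `G'` is unitarily equivalent to the defect range of `π'`, so only defect
  -- ranges need to be compared.
  obtain ⟨V⟩ := hG'.exists_unitary_defectSpace hf π' h1' hr
  have hdim := hilbertDim_eq_of_unitary V
  constructor
  · intro h
    exact ⟨(h.hilbertDim_defectSpace hf h1 h1').trans hdim.symm,
      h.restrict_orthogonal hf h1 h1' h0' hr'⟩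
  · rintro ⟨h, h'⟩
    have := completeSpace_defectSpace hf π h1
    have := completeSpace_defectSpace hf π' h1'
    have := separableSpace_submodule (defectSpace f π)
    have := separableSpace_submodule (defectSpace f π')
    obtain ⟨W⟩ := exists_unitary_of_hilbertDim_eq (h.trans hdim)
    exact unitarilyEquiv_of_defectSpace hf h1 h1' h0' hr' W h'
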